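/- Let $K$ be a field, $\mathcal Q$ a finite quiver (arrows in a path are read from left to right), $I$ an admissible ideal of $K\mathcal Q$, and $\Lambda=K\mathcal Q/I$; all modules are finite-dimensional right modules and $\mathfrak r$ denotes the Jacobson radical of $\Lambda$. Write $\mathfrak t(x)$ for the vertex at which a nonzero uniform element $x$ ends, where $x\in K\mathcal Q$ is uniform if $x=vx=xv'$ for some vertices $v,v'$. *Resolutions given by sets.* Let $(g^n)_{n\ge 0}$ be finite sets of nonzero uniform elements of $K\mathcal Q$ such that $g^0$ is the set of vertices, $g^1$ is the set of arrows and $g^2$ is a minimal generating set of the ideal $I$. We say that these sets define a minimal projective resolution $(P^n,d^n)$ of $\Lambda/\mathfrak r$ if * for all $n\ge 1$, every $x\in g^n$ can be written as $x=\sum_{y\in g^{n-1}}y\,r_{x,y}$ with unique $r_{x,y}\in \mathfrak t(y)K\mathcal Q$; * for all $n\ge 3$, every $x\in g^n$ can be written as $x=\sum_{y\in g^{n-2}}y\,s_{x,y}$ with unique $s_{x,y}\in \mathfrak t(y)K\mathcal Q\cap I$; * with $P^n=\bigoplus_{x\in g^n}\mathfrak t(x)\Lambda$, with $d^0:P^0\to\Lambda/\mathfrak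 r$ the canonical surjection, and with $d^n:P^n\to P^{n-1}$ $(n\ge 1)$ the $\Lambda$-homomorphism for which $d^n(\mathfrak t(x))$ has entry $\mathfrak t(y)r_{x,y}$ in the summand $\mathfrak t(y)\Lambda$ for every $y\in g^{n-1}$, the sequence $\cdots\to P^1\to P^0\to\Lambda/\mathfrak r\to 0$ is a minimal projective resolution of the right $\Lambda$-module $\Lambda/\mathfrak r$ (it is exact, every $P^n$ is projective, and $\operatorname{Im} d^{n}\subseteq \operatorname{rad}P^{n-1}$ for $n\ge 1$). *The stretched algebra.* Let $A\ge 1$. The quiver $\tilde{\mathcal Q}$ is obtained from $\mathcal Q$ by replacing each arrow $\alpha$ by a path $\alpha_1\alpha_2\cdots\alpha_A$ from the start to the end of $\alpha$ that passes through $A-1$ new vertices $w_1,\dots,w_{A-1}$ (different ones for different arrows). Let $\theta^*:K\mathcal Q\to K\tilde{\mathcal Q}$ be the (not necessarily unital) homomorphism of $K$-algebras with $v\mapsto v$ for each vertex $v$ and $\alpha\mapsto\alpha_1\cdots\alpha_A$ for each arrow $\alpha$. Let $\tilde I$ be the ideal of $K\tilde{\mathcal Q}$ generated by $\theta^*(g^2)$,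 let $\tilde\Lambda=K\tilde{\mathcal Q}/\tilde I$, and let $\tilde{\mathfrak r}$ be its Jacobson radical. **Theorem.** Suppose that the sets $g^n$ define a minimal projective resolution $(P^n,d^n)$ of $\Lambda/\mathfrak r$. Let $\tilde g^0$ be the set of vertices of $\tilde{\mathcal Q}$, let $\tilde g^1$ be the set of arrows of $\tilde{\mathcal Q}$, and let $\tilde g^n=\theta^*(g^n)$ for $n\ge 2$. Then the sets $\tilde g^n$ define, in the sense above (over $\tilde{\mathcal Q}$, $\tilde I$, $\tilde\Lambda$), a minimal projective resolution $(\tilde P^n,\tilde d^n)$ of the right $\tilde\Lambda$-module $\tilde\Lambda/\tilde{\mathfrak r}$. Moreover, its differentials are induced by $\theta^*$ in degrees $n\ge 3$: for $x\in g^n$ and $y\in g^{n-1}$, the coefficient of $\theta^*(y)$ in the expansion of $\theta^*(x)$ is $\theta^*(r_{x,y})$. -/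

import Mathlib

open MulOpposite

noncomputable section

universe u v w

/-! ## The path algebra of a finite quiver -/

/-- The path algebra `K𝒬`: the `K`-vector space with basis the set of all paths of the quiver
(paths are composed from left to right). -/
def PathAlgebra (K : Type w) (V : Type u) [Field K] [Quiver.{v} V] : Type (max u v w) :=
  (Σ a b : V, Quiver.Path a b) →₀ K

namespace PathAlgebra

variable {K : Type w} {V : Type u} [Field K] [Quiver.{v} V]

instance : AddCommGroup (PathAlgebra K V) :=
  inferInstanceAs (AddCommGroup ((Σ a b : V, Quiver.Path a b) →₀ K))

instance : Module K (PathAlgebra K V) :=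
  inferInstanceAs (Module K ((Σ a b : V, Quiver.Path a b) →₀ K))

/-- The basis element of `K𝒬` given by a path. -/
def ofPath {a b : V} (p : Quiver.Path a b) : PathAlgebra K V :=
  Finsupp.single (⟨a, b, p⟩ : Σ a b : V, Quiver.Path a b) 1

/-- The linear map on `K𝒬` with prescribed values on the paths. -/
def linLift {M : Type*} [AddCommGroup M] [Module K M]
    (f : ∀ a b : V, Quiver.Path a b → M) : PathAlgebra K V →ₗ[K] M :=
  Finsupp.linearCombination K (fun p : Σ a b : V, Quiver.Path a b => f p.1 p.2.1 p.2.2)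

@[simp] theorem linLift_ofPath {M : Type*} [AddCommGroup M] [Module K M]
    (f : ∀ a b : V, Quiver.Path a b → M) {a b : V} (p : Quiver.Path a b) :
    linLift (K := K) f (ofPath p) = f a b p := by
  exact (Finsupp.linearCombination_single K 1
    (⟨a, b, p⟩ : Σ a b : V, Quiver.Path a b)).trans (one_smul K _)

theorem linHom_ext {M : Type*} [AddCommGroup M] [Module K M] {f g : PathAlgebra K V →ₗ[K] M}
    (h : ∀ (a b : V) (p : Quiver.Path a b), f (ofPath p) = g (ofPath p)) : f = g := by
  refine Finsupp.lhom_ext' (φ := f) (ψ := g) fun p => LinearMap.ext_ring ?_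
  exact h p.1 p.2.1 p.2.2

open scoped Classical in
/-- The product of two paths: their concatenation if the first one ends where the second one
starts, and `0` otherwise. -/
def mulPath {a b c d : V} (p : Quiver.Path a b) (q : Quiver.Path c d) : PathAlgebra K V :=
  if h : b = c then ofPath (p.comp (q.cast h.symm rfl)) else 0

/-- The multiplication of `K𝒬`, as a bilinear map. -/
def mulLin : PathAlgebra K V →ₗ[K] PathAlgebra K V →ₗ[K] PathAlgebra K V :=
  linLift fun _ _ p => linLift fun _ _ q => mulPath p q

instance : Mul (PathAlgebra K V) := ⟨fun x y => mulLin x y⟩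

theorem mul_def (x y : PathAlgebra K V) : x * y = mulLin x y := rfl

theorem ofPath_mul_ofPath {a b c : V} (p : Quiver.Path a b) (q : Quiver.Path b c) :
    (ofPath p * ofPath q : PathAlgebra K V) = ofPath (p.comp q) := by
  simp [mul_def, mulLin, mulPath]

theorem ofPath_mul_ofPath_of_ne {a b c d : V} (p : Quiver.Path a b) (q : Quiver.Path c d)
    (h : b ≠ c) : (ofPath p * ofPath q : PathAlgebra K V) = 0 := by
  simp [mul_def, mulLin, mulPath, h]

/-- The vertex `a`, that is, the trivial path at `a`. -/
def vertex (a : V) : PathAlgebra K V := ofPath (Quiver.Path.nil : Quiver.Path a a)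

/-- An arrow, as a path of length one. -/
def arrow (α : Quiver.Total V) : PathAlgebra K V := ofPath α.hom.toPath

theorem mul_assoc_aux (x y z : PathAlgebra K V) : x * y * z = x * (y * z) := by
  have key : ∀ (a b c d e f : V) (p : Quiver.Path a b) (q : Quiver.Path c d)
      (r : Quiver.Path e f), (ofPath p * ofPath q * ofPath r : PathAlgebra K V) =
        ofPath p * (ofPath q * ofPath r) := by
    intro a b c d e f p q r
    by_cases h : b = c
    · subst h
      rw [ofPath_mul_ofPath]
      by_cases h' : d = e
      · subst h'
        rw [ofPath_mul_ofPath, ofPath_mul_ofPath, ofPath_mul_ofPath, Quiver.Path.comp_assoc]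
      · rw [ofPath_mul_ofPath_of_ne _ _ h', ofPath_mul_ofPath_of_ne _ _ h']
        exact (map_zero (mulLin (ofPath p))).symm
    · rw [ofPath_mul_ofPath_of_ne _ _ h]
      have h0 : ((0 : PathAlgebra K V) * ofPath r) = 0 := by
        simp only [mul_def, map_zero, LinearMap.zero_apply]
      rw [h0]
      by_cases h' : d = e
      · subst h'
        rw [ofPath_mul_ofPath, ofPath_mul_ofPath_of_ne _ _ h]
      · rw [ofPath_mul_ofPath_of_ne _ _ h']
        exact (map_zero (mulLin (ofPath p))).symm
  have : (mulLin : PathAlgebra K V →ₗ[K] _).compr₂ mulLin =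
      ((LinearMap.llcomp K (PathAlgebra K V) (PathAlgebra K V) (PathAlgebra K V)).comp
        mulLin).compl₂ mulLin := by
    refine linHom_ext fun a b p => linHom_ext fun c d q => linHom_ext fun e f r => ?_
    exact key a b c d e f p q r
  exact LinearMap.congr_fun (LinearMap.congr_fun (LinearMap.congr_fun this x) y) z

variable [Fintype V]

instance : One (PathAlgebra K V) := ⟨∑ a : V, vertex a⟩

theorem one_def : (1 : PathAlgebra K V) = ∑ a : V, vertex a := rfl

theorem one_mul_aux (x : PathAlgebra K V) : 1 * x = x := by
  classical
  have : (mulLin (1 : PathAlgebra K V)) = LinearMap.id := by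
    refine linHom_ext fun a b p => ?_
    rw [one_def, map_sum, LinearMap.sum_apply, Finset.sum_eq_single a]
    · exact (ofPath_mul_ofPath _ p).trans (by simp)
    · intro c _ hc
      exact ofPath_mul_ofPath_of_ne _ p hc
    · simp
  exact LinearMap.congr_fun this x

theorem mul_one_aux (x : PathAlgebra K V) : x * 1 = x := by
  classical
  have : (mulLin.flip (1 : PathAlgebra K V)) = LinearMap.id := by
    refine linHom_ext fun a b p => ?_
    rw [one_def, map_sum, LinearMap.sum_apply, Finset.sum_eq_single b]
    · exact (ofPath_mul_ofPath p _).trans (by simp)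
    · intro c _ hc
      exact ofPath_mul_ofPath_of_ne p _ hc.symm
    · simp
  exact LinearMap.congr_fun this x

instance : Ring (PathAlgebra K V) where
  __ := (inferInstance : AddCommGroup (PathAlgebra K V))
  left_distrib x y z := map_add (mulLin x) y z
  right_distrib x y z := by simp only [mul_def, map_add, LinearMap.add_apply]
  zero_mul x := by simp only [mul_def, map_zero, LinearMap.zero_apply]
  mul_zero x := map_zero (mulLin x)
  mul_assoc := mul_assoc_aux
  one_mul := one_mul_aux
  mul_one := mul_one_aux

instance : Algebra K (PathAlgebra K V) :=
  Algebra.ofModule (fun r x y => by simp only [mul_def, map_smul, LinearMap.smul_apply])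
    (fun r x y => map_smul (mulLin x) r y)

end PathAlgebra

/-! ## The stretched quiver -/

/-- The vertices of the stretched quiver `𝒬̃_A`: the vertices of `𝒬`, and for every arrow `α` of `𝒬`
new vertices `w₁, …, w_{A-1}`; the pair `(α, j)` stands for `w_{j+1}`. -/
def Stretched (A : ℕ) (V : Type u) [Quiver.{v} V] : Type (max u v) :=
  V ⊕ Quiver.Total V × Fin (A - 1)

namespace Stretched

variable {A : ℕ} {V : Type u} [Quiver.{v} V]

/-- A vertex of `𝒬`, regarded as a vertex of `𝒬̃_A`. -/
def old (a : V) : Stretched A V := Sum.inl a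

/-- The vertices `𝔬(α) = pt α 0, w₁ = pt α 1, …, w_{A-1} = pt α (A-1), 𝔱(α) = pt α A` that are
passed by the path which replaces the arrow `α`. -/
def pt (α : Quiver.Total V) (j : ℕ) : Stretched A V :=
  if j = 0 then Sum.inl α.left
  else if h : j - 1 < A - 1 then Sum.inr (α, ⟨j - 1, h⟩)
  else Sum.inl α.right

/-- The arrows of `𝒬̃_A` are the pairs `(α, i)` with `α` an arrow of `𝒬` and `0 ≤ i < A`; such a pair
stands for the arrow `α_{i+1}`, which goes from `pt α i` to `pt α (i + 1)`. -/
instance : Quiver.{max u v} (Stretched A V) where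
  Hom x y := {β : Quiver.Total V × Fin A //
    pt (A := A) β.1 β.2 = x ∧ pt (A := A) β.1 (β.2 + 1) = y}

/-- The arrow `α_{i+1}` of `𝒬̃_A`. -/
def arr (α : Quiver.Total V) (i : Fin A) : Quiver.Total (Stretched A V) :=
  ⟨pt α i, pt α (i + 1), ⟨(α, i), rfl, rfl⟩⟩

theorem arr_surjective :
    Function.Surjective fun β : Quiver.Total V × Fin A => arr β.1 β.2 := by
  rintro ⟨x, y, ⟨⟨α, i⟩, rfl, rfl⟩⟩
  exact ⟨(α, i), rfl⟩

variable [Fintype V] [Fintype (Quiver.Total V)]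

instance : Fintype (Stretched A V) :=
  inferInstanceAs (Fintype (V ⊕ Quiver.Total V × Fin (A - 1)))

instance : Fintype (Quiver.Total (Stretched A V)) :=
  haveI : Finite (Quiver.Total (Stretched A V)) := Finite.of_surjective _ arr_surjective
  Fintype.ofFinite _

variable {K : Type w} [Field K]

/-- The element `α₁ α₂ ⋯ α_A` of `K𝒬̃_A` (the product is multiplied by its first and its last vertex,
which changes nothing when `A ≥ 1`). -/
def thetaArrow (A : ℕ) (α : Quiver.Total V) : PathAlgebra K (Stretched A V) :=
  PathAlgebra.vertex (old α.left) *
    (List.ofFn fun i : Fin A => PathAlgebra.arrow (K := K) (arr α i)).prod *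
    PathAlgebra.vertex (old α.right)

/-- The image of a path of `𝒬` in `K𝒬̃_A`: every arrow `α` is replaced by `α₁ α₂ ⋯ α_A`. -/
def thetaPath (A : ℕ) {a : V} : ∀ {b : V}, Quiver.Path a b → PathAlgebra K (Stretched A V)
  | _, .nil => PathAlgebra.vertex (old a)
  | _, .cons p α => thetaPath A p * thetaArrow A ⟨_, _, α⟩

theorem vertex_mul_self {W : Type*} [Quiver W] [Fintype W] (a : W) :
    (PathAlgebra.vertex a * PathAlgebra.vertex a : PathAlgebra K W) = PathAlgebra.vertex a :=
  PathAlgebra.ofPath_mul_ofPath _ _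

theorem vertex_mul_of_ne {W : Type*} [Quiver W] [Fintype W] {a b : W} (h : a ≠ b) :
    (PathAlgebra.vertex a * PathAlgebra.vertex b : PathAlgebra K W) = 0 :=
  PathAlgebra.ofPath_mul_ofPath_of_ne _ _ h

theorem vertex_mul_thetaPath {a b : V} (p : Quiver.Path a b) :
    PathAlgebra.vertex (old a) * thetaPath (K := K) A p = thetaPath A p := by
  induction p with
  | nil => exact vertex_mul_self _
  | cons p α ih => rw [thetaPath, ← mul_assoc, ih]

theorem thetaPath_mul_vertex {a b : V} (p : Quiver.Path a b) :
    thetaPath (K := K) A p * PathAlgebra.vertex (old b) = thetaPath A p := by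
  cases p with
  | nil => exact vertex_mul_self _
  | cons p α => rw [thetaPath, thetaArrow, mul_assoc, mul_assoc, vertex_mul_self]

theorem thetaPath_comp {a b c : V} (p : Quiver.Path a b) (q : Quiver.Path b c) :
    thetaPath (K := K) A (p.comp q) = thetaPath A p * thetaPath A q := by
  induction q with
  | nil => exact (thetaPath_mul_vertex p).symm
  | cons q α ih => rw [Quiver.Path.comp_cons, thetaPath, thetaPath, ih, mul_assoc]

theorem thetaPath_mul_of_ne {a b c d : V} (p : Quiver.Path a b) (q : Quiver.Path c d)
    (h : b ≠ c) : thetaPath (K := K) A p * thetaPath A q = 0 := by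
  have hne : (old b : Stretched A V) ≠ old c := fun e => h (Sum.inl_injective e)
  rw [← thetaPath_mul_vertex p, ← vertex_mul_thetaPath q, mul_assoc,
    ← mul_assoc (PathAlgebra.vertex _), vertex_mul_of_ne hne, zero_mul, mul_zero]

/-- The homomorphism of `K`-algebras `θ* : K𝒬 → K𝒬̃_A` with `v ↦ v` for every vertex `v` and
`α ↦ α₁ α₂ ⋯ α_A` for every arrow `α`. It sends `1` to the idempotent `∑_{v ∈ 𝒬₀} v`, so it
is not unital in general. -/
def theta (K : Type w) [Field K] (A : ℕ) (V : Type u) [Quiver.{v} V] [Fintype V]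
    [Fintype (Quiver.Total V)] : PathAlgebra K V →ₙₐ[K] PathAlgebra K (Stretched A V) where
  toFun := PathAlgebra.linLift fun _ _ p => thetaPath (K := K) A p
  map_smul' := map_smul _
  map_zero' := map_zero _
  map_add' := map_add _
  map_mul' x y := by
    have : (PathAlgebra.mulLin (K := K) (V := V)).compr₂
          (PathAlgebra.linLift fun _ _ p => thetaPath (K := K) A p) =
        ((PathAlgebra.mulLin (K := K) (V := Stretched A V)).compl₁₂
          (PathAlgebra.linLift fun _ _ p => thetaPath A p)
          (PathAlgebra.linLift fun _ _ p => thetaPath A p)) := by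
      refine PathAlgebra.linHom_ext fun a b p => PathAlgebra.linHom_ext fun c d q => ?_
      change PathAlgebra.linLift (fun _ _ p => thetaPath (K := K) A p)
          (PathAlgebra.ofPath p * PathAlgebra.ofPath q) =
        PathAlgebra.linLift (fun _ _ p => thetaPath (K := K) A p) (PathAlgebra.ofPath p) *
          PathAlgebra.linLift (fun _ _ p => thetaPath (K := K) A p) (PathAlgebra.ofPath q)
      by_cases h : b = c
      · subst h
        rw [PathAlgebra.ofPath_mul_ofPath]
        simp only [PathAlgebra.linLift_ofPath, thetaPath_comp]
      · rw [PathAlgebra.ofPath_mul_ofPath_of_ne _ _ h, map_zero]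
        simp only [PathAlgebra.linLift_ofPath, thetaPath_mul_of_ne _ _ h]
    exact LinearMap.congr_fun (LinearMap.congr_fun this x) y

end Stretched

/-! ## Minimal projective resolutions -/

/-- `⋯ → P 2 → P 1 → P 0 → M → 0`, with differentials `d n : P (n + 1) → P n` and augmentation
`ε : P 0 → M`, is a minimal projective resolution of the `R`-module `M`: it is exact, every `P n` is
projective, and the image of every differential lies in the radical of its target. -/
structure IsMinimalProjectiveResolution {R : Type*} [Ring R] {M : Type*} [AddCommGroup M]
    [Module R M] {P : ℕ → Type*} [∀ n, AddCommGroup (P n)] [∀ n, Module R (P n)]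
    (ε : P 0 →ₗ[R] M) (d : ∀ n, P (n + 1) →ₗ[R] P n) : Prop where
  projective : ∀ n, Module.Projective R (P n)
  surjective : Function.Surjective ε
  exact_zero : Function.Exact (d 0) ε
  exact_succ : ∀ n, Function.Exact (d (n + 1)) (d n)
  minimal : ∀ n, LinearMap.range (d n) ≤ Module.jacobson R (P n)

/-! ## Resolutions given by sets of uniform elements -/

namespace PathAlgebra

variable {K : Type w} {V : Type u} [Field K] [Quiver.{v} V]

/-- The `m`-th power of the arrow ideal: the span of the paths of length at least `m`. -/
def arrowIdealPow (K : Type w) (V : Type u) [Field K] [Quiver.{v} V] (m : ℕ) :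
    Submodule K (PathAlgebra K V) :=
  Submodule.span K {x | ∃ (a b : V) (p : Quiver.Path a b), m ≤ p.length ∧ x = ofPath p}

variable [Fintype V]

/-- An ideal `I` of `K𝒬` is admissible if `J ^ N ⊆ I ⊆ J ^ 2` for some `N ≥ 2`, with `J` the
arrow ideal. -/
def IsAdmissible (I : TwoSidedIdeal (PathAlgebra K V)) : Prop :=
  (∀ x ∈ I, x ∈ arrowIdealPow K V 2) ∧ ∃ N, 2 ≤ N ∧ ∀ x ∈ arrowIdealPow K V N, x ∈ I

/-- `x` is a nonzero uniform element: `x = v x = x v'` for some vertices `v` and `v'`. -/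
def IsUniform (x : PathAlgebra K V) : Prop :=
  x ≠ 0 ∧ (∃ a : V, vertex a * x = x) ∧ ∃ b : V, x * vertex b = x

open scoped Classical in
/-- The vertex `𝔱(x)` at which a nonzero uniform element `x` ends, as an element of `K𝒬`. -/
def terminus (x : PathAlgebra K V) : PathAlgebra K V :=
  if h : ∃ b : V, x * vertex b = x then vertex h.choose else 0

/-- The algebra `Λ = K𝒬/I`. -/
abbrev Quot (I : TwoSidedIdeal (PathAlgebra K V)) := I.ringCon.Quotient

/-- The right `Λ`-module `Λ/𝔯`, where `𝔯` is the Jacobson radical of `Λ`, the intersection of its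
maximal right ideals. -/
abbrev TopModule (I : TwoSidedIdeal (PathAlgebra K V)) :=
  Quot I ⧸ Module.jacobson (Quot I)ᵐᵒᵖ (Quot I)

/-- The right `Λ`-module `𝔱(x)Λ`. -/
def terminusModule (I : TwoSidedIdeal (PathAlgebra K V)) (x : PathAlgebra K V) :
    Submodule (Quot I)ᵐᵒᵖ (Quot I) :=
  Submodule.span (Quot I)ᵐᵒᵖ {I.ringCon.mk' (terminus x)}

/-- The right `Λ`-module `⨁_{x ∈ G} 𝔱(x)Λ` for a finite set `G`. -/
abbrev Proj (I : TwoSidedIdeal (PathAlgebra K V)) (G : Finset (PathAlgebra K V)) :=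
  ∀ x : G, terminusModule I (x : PathAlgebra K V)

theorem mk_terminus_mul_mem (I : TwoSidedIdeal (PathAlgebra K V)) (x : PathAlgebra K V)
    (a : Quot I) : I.ringCon.mk' (terminus x) * a ∈ terminusModule I x :=
  Submodule.smul_mem _ (op a) (Submodule.mem_span_singleton_self _)

/-- The map `⨁_{x ∈ G} 𝔱(x)Λ → Λ/𝔯` induced by the inclusions `𝔱(x)Λ ⊆ Λ` and the canonical
surjection; if `G` is the set of vertices then this is the canonical surjection `Λ → Λ/𝔯`. -/
def augmentation (I : TwoSidedIdeal (PathAlgebra K V)) (G : Finset (PathAlgebra K V)) :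
    Proj I G →ₗ[(Quot I)ᵐᵒᵖ] TopModule I :=
  (Submodule.mkQ _).comp (∑ x : G, (Submodule.subtype _).comp (LinearMap.proj x))

/-- The homomorphism `⨁_{x ∈ G'} 𝔱(x)Λ → ⨁_{y ∈ G} 𝔱(y)Λ` of right `Λ`-modules that sends `𝔱(x)` to
the element with entry `𝔱(y) r(x, y) 𝔱(x)` in the summand `𝔱(y)Λ`. -/
def differential (I : TwoSidedIdeal (PathAlgebra K V)) (G' G : Finset (PathAlgebra K V))
    (r : PathAlgebra K V → PathAlgebra K V → PathAlgebra K V) :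
    Proj I G' →ₗ[(Quot I)ᵐᵒᵖ] Proj I G where
  toFun p y := ⟨∑ x : G', I.ringCon.mk' (terminus (y : PathAlgebra K V)) *
      (I.ringCon.mk' (r x y) * (p x : Quot I)),
    Submodule.sum_mem _ fun _ _ => mk_terminus_mul_mem I _ _⟩
  map_add' p q := by
    funext y
    apply Subtype.ext
    simp [mul_add, Finset.sum_add_distrib]
  map_smul' c p := by
    funext y
    apply Subtype.ext
    simp [Finset.sum_mul, mul_assoc]

/-- `x = ∑_{y ∈ G} y c(y)` with coefficients `c(y) ∈ 𝔱(y) K𝒬`. -/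
def IsExpansion (G : Finset (PathAlgebra K V)) (x : PathAlgebra K V)
    (c : PathAlgebra K V → PathAlgebra K V) : Prop :=
  (∀ y ∈ G, terminus y * c y = c y) ∧ x = ∑ y ∈ G, y * c y

/-- The sets `g n` of uniform elements (with `g 0` the vertices, `g 1` the arrows, `g 2` a minimal
generating set of `I`) define a minimal projective resolution
`P n = ⨁_{x ∈ g n} 𝔱(x)Λ` of the right module `Λ/𝔯` over `Λ = K𝒬/I`. Here `r n x y ∈ K𝒬`, for
`x ∈ g (n + 1)` and `y ∈ g n`, are the unique coefficients in `x = ∑_y y (r n x y)`, and they give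
the differential `P (n + 1) → P n`. -/
structure IsResolutionBySets (I : TwoSidedIdeal (PathAlgebra K V))
    (g : ℕ → Finset (PathAlgebra K V))
    (r : ℕ → PathAlgebra K V → PathAlgebra K V → PathAlgebra K V) : Prop where
  g_zero : (g 0 : Set (PathAlgebra K V)) = Set.range vertex
  g_one : (g 1 : Set (PathAlgebra K V)) = Set.range arrow
  g_two_span : TwoSidedIdeal.span (g 2 : Set (PathAlgebra K V)) = I
  g_two_minimal : ∀ S : Set (PathAlgebra K V), S ⊂ g 2 → TwoSidedIdeal.span S ≠ I
  uniform : ∀ n, ∀ x ∈ g n, IsUniform x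
  expansion : ∀ n, ∀ x ∈ g (n + 1), IsExpansion (g n) x (r n x)
  expansion_unique : ∀ n, ∀ x ∈ g (n + 1), ∀ c, IsExpansion (g n) x c →
    ∀ y ∈ g n, c y = r n x y
  expansion_ideal : ∀ n, ∀ x ∈ g (n + 3), ∃ s, IsExpansion (g (n + 1)) x s ∧
    (∀ y ∈ g (n + 1), s y ∈ I) ∧
    ∀ s', IsExpansion (g (n + 1)) x s' → (∀ y ∈ g (n + 1), s' y ∈ I) →
      ∀ y ∈ g (n + 1), s' y = s y
  resolution : IsMinimalProjectiveResolution (P := fun n => Proj I (g n))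
    (augmentation I (g 0)) (fun n => differential I (g (n + 1)) (g n) (r n))

end PathAlgebra

namespace Stretched

variable {K : Type w} [Field K] {V : Type u} [Quiver.{v} V] [Fintype V]
  [Fintype (Quiver.Total V)]

/-- The ideal `Ĩ_A` of `K𝒬̃_A` generated by the elements `θ*(x)`, where `x` runs through a set of
generators of `I`; the stretched algebra is `Λ̃_A = K𝒬̃_A/Ĩ_A`. -/
def ideal (A : ℕ) (G : Set (PathAlgebra K V)) :
    TwoSidedIdeal (PathAlgebra K (Stretched A V)) :=
  TwoSidedIdeal.span (theta K A V '' G)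

open scoped Classical in
/-- The sets `g̃ⁿ`: the vertices of `𝒬̃_A`, the arrows of `𝒬̃_A`, and `θ*(gⁿ)` for `n ≥ 2`. -/
def sets (A : ℕ) (g : ℕ → Finset (PathAlgebra K V)) :
    ℕ → Finset (PathAlgebra K (Stretched A V))
  | 0 => Finset.univ.image PathAlgebra.vertex
  | 1 => Finset.univ.image PathAlgebra.arrow
  | n + 2 => (g (n + 2)).image (theta K A V)

end Stretched

end

noncomputable section

universe u v w

/-! ### Linear algebra on the basis of paths -/

namespace PathAlgebra

variable {K : Type w} {V : Type u} [Field K] [Quiver.{v} V]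

/-! Put e = θ*(1), the sum of the old vertices. A path of 𝒬̃ that starts at an old vertex is, in a
unique way, θ* of a path of 𝒬 followed by a stub, that is, an initial segment α₁⋯α_j with j < A. So,
as a left K𝒬-module via θ*, eK𝒬̃ is the direct sum of the pieces θ*(K𝒬)·`stub x` over all vertices x
of 𝒬̃, and the maps `coord x` are left K𝒬-linear coordinates (`theta_one_mul`, `coord_theta_mul`).
Since eK𝒬̃e = θ*(K𝒬), the coordinates carry Ĩ into I (`coord_mem_span`). A linear system modulo Ĩ
with coefficients in θ*(K𝒬) therefore splits into systems modulo I, one for each x. In this way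
exactness over Λ passes to Λ̃ (`exists_coeff_of_exact`).

Vertices and arrows need separate care. Exactness at P̃⁰ and P̃¹ is general: it uses only the
radical and the generators of the ideal (`exact_augmentation`, `exact_differential_arrows`). At P̃²
the entry of the differential at the arrow α₁ is α₂⋯α_A θ*(r). The factor α₂⋯α_A cancels modulo Ĩ,
because the derivatives along α₂, …, α_A preserve Ĩ: the generators of Ĩ start at old vertices
(`leftDeriv_mem_ideal`, `exists_arrow_mul_eq`). What remains is a system with coefficients θ*(r).

For minimality, Ĩ contains a power of the arrow ideal (`arrowIdealPow_subset_ideal`), so the radical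
consists of the classes without constant coefficients. The differentials then land in the radical
exactly when their entries have no constant coefficients (`range_differential_le_jacobson_iff`), a
property that θ* preserves. -/

theorem induction_on {P : PathAlgebra K V → Prop} (x : PathAlgebra K V) (zero : P 0)
    (add : ∀ x y, P x → P y → P (x + y))
    (smul_path : ∀ (k : K) (a b : V) (p : Quiver.Path a b), P (k • ofPath p)) : P x := by
  refine Finsupp.induction_linear (motive := P) x zero add fun p k => ?_
  have := smul_path k p.1 p.2.1 p.2.2
  have e : (k • ofPath p.2.2 : PathAlgebra K V) = Finsupp.single p k := by
    exact (Finsupp.smul_single k p (1 : K)).trans (by rw [smul_eq_mul, mul_one])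
  rwa [e] at this

theorem ofPath_ne_zero {a b : V} (p : Quiver.Path a b) : (ofPath p : PathAlgebra K V) ≠ 0 :=
  Finsupp.single_ne_zero.2 one_ne_zero

theorem vertex_mul_ofPath {a b : V} (p : Quiver.Path a b) :
    (vertex a * ofPath p : PathAlgebra K V) = ofPath p := by
  rw [vertex, ofPath_mul_ofPath, Quiver.Path.nil_comp]

theorem ofPath_mul_vertex {a b : V} (p : Quiver.Path a b) :
    (ofPath p * vertex b : PathAlgebra K V) = ofPath p := by
  rw [vertex, ofPath_mul_ofPath, Quiver.Path.comp_nil]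

theorem ofPath_cons {a b c : V} (p : Quiver.Path a b) (α : b ⟶ c) :
    (ofPath (p.cons α) : PathAlgebra K V) = ofPath p * arrow ⟨b, c, α⟩ := by
  rw [arrow, ofPath_mul_ofPath]; rfl

/-- Unbundled form of extensionality for bilinear maps, so that product rules can be checked on
pairs of paths. -/
theorem bilin_ext {W : Type*} [Quiver W] {M : Type*} [AddCommGroup M] [Module K M]
    {f g : PathAlgebra K V → PathAlgebra K W → M}
    (fl : ∀ y, IsLinearMap K fun x => f x y) (fr : ∀ x, IsLinearMap K (f x))
    (gl : ∀ y, IsLinearMap K fun x => g x y) (gr : ∀ x, IsLinearMap K (g x))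
    (h : ∀ (a b : V) (c d : W) (p : Quiver.Path a b) (q : Quiver.Path c d),
      f (ofPath p) (ofPath q) = g (ofPath p) (ofPath q)) (x : PathAlgebra K V)
    (y : PathAlgebra K W) : f x y = g x y := by
  induction x using induction_on with
  | zero => rw [(fl y).map_zero, (gl y).map_zero]
  | add x x' hx hx' => rw [(fl y).map_add, (gl y).map_add, hx, hx']
  | smul_path k a b p =>
    rw [(fl y).map_smul, (gl y).map_smul]
    congr 1
    induction y using induction_on with
    | zero => rw [(fr _).map_zero, (gr _).map_zero]
    | add x x' hx hx' => rw [(fr _).map_add, (gr _).map_add, hx, hx']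
    | smul_path k c d q => rw [(fr _).map_smul, (gr _).map_smul, h]

theorem vertex_mul_arrow (β : Quiver.Total V) :
    (vertex β.left * arrow β : PathAlgebra K V) = arrow β := vertex_mul_ofPath _

theorem arrow_mul_vertex (β : Quiver.Total V) :
    (arrow β * vertex β.right : PathAlgebra K V) = arrow β := ofPath_mul_vertex _

theorem ofPath_mem_arrowIdealPow {a b : V} (p : Quiver.Path a b) {m : ℕ} (h : m ≤ p.length) :
    (ofPath p : PathAlgebra K V) ∈ arrowIdealPow K V m :=
  Submodule.subset_span ⟨a, b, p, h, rfl⟩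

theorem mem_arrowIdealPow_zero (x : PathAlgebra K V) : x ∈ arrowIdealPow K V 0 := by
  induction x using induction_on with
  | zero => exact Submodule.zero_mem _
  | add x y hx hy => exact Submodule.add_mem _ hx hy
  | smul_path k a b p =>
    exact Submodule.smul_mem _ k (ofPath_mem_arrowIdealPow p (Nat.zero_le _))

theorem arrow_mem_arrowIdealPow (β : Quiver.Total V) :
    (arrow β : PathAlgebra K V) ∈ arrowIdealPow K V 1 :=
  ofPath_mem_arrowIdealPow _ le_rfl

variable [Fintype V]

/-! ### Constant coefficients and left derivatives -/

open scoped Classical in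
/-- The coefficient of the trivial path at `v`. -/
def constCoeff (v : V) : PathAlgebra K V →ₗ[K] K :=
  linLift fun a _ p => if p.length = 0 ∧ a = v then 1 else 0

open scoped Classical in
theorem constCoeff_ofPath (v : V) {a b : V} (p : Quiver.Path a b) :
    constCoeff (K := K) v (ofPath p) = if p.length = 0 ∧ a = v then 1 else 0 :=
  linLift_ofPath _ p

theorem constCoeff_vertex (v : V) : constCoeff (K := K) v (vertex v) = 1 := by
  simp [vertex, constCoeff_ofPath]

theorem constCoeff_arrow (v : V) (β : Quiver.Total V) :
    constCoeff (K := K) v (arrow β) = 0 := by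
  simp [arrow, constCoeff_ofPath]

/-- A concatenation is the trivial path at `v` only if both factors are. Thus `constCoeff v` is a
character of K𝒬; its kernel induces a maximal right ideal of Λ. -/
theorem constCoeff_mul (v : V) (x y : PathAlgebra K V) :
    constCoeff v (x * y) = constCoeff v x * constCoeff v y := by
  refine bilin_ext (f := fun x y => constCoeff v (x * y))
    (g := fun x y => constCoeff v x * constCoeff v y)
    (fun y => ⟨by simp [add_mul], by simp⟩) (fun y => ⟨by simp [mul_add], by simp⟩)
    (fun y => ⟨by simp [add_mul], by simp [mul_assoc]⟩)
    (fun y => ⟨by simp [mul_add], by simp [mul_left_comm]⟩) ?_ x y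
  intro a b c d p q
  by_cases h : b = c
  · subst h
    simp only [ofPath_mul_ofPath, constCoeff_ofPath, Quiver.Path.length_comp]
    by_cases hp : p.length = 0
    · have := Quiver.Path.eq_of_length_zero p hp
      subst this
      by_cases hq : q.length = 0 <;> by_cases hv : a = v <;> simp [hp, hq, hv]
    · simp [hp]
  · simp only [ofPath_mul_ofPath_of_ne _ _ h, constCoeff_ofPath, map_zero]
    by_cases hp : p.length = 0
    · have := Quiver.Path.eq_of_length_zero p hp
      subst this
      by_cases hv : a = v
      · subst hv; simp [Ne.symm h]
      · simp [hv]
    · simp [hp]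

open scoped Classical in
/-- The value of the left derivative along an arrow `β` on a path: the path without its first arrow
if this first arrow is `β`, and `0` otherwise. -/
def leftDerivPath (β : Quiver.Total V) {a : V} : ∀ {b : V}, Quiver.Path a b → PathAlgebra K V
  | _, .nil => 0
  | _, .cons p α => leftDerivPath β p * arrow ⟨_, _, α⟩ +
      constCoeff (K := K) β.left (ofPath p) • if (⟨_, _, α⟩ : Quiver.Total V) = β then
        vertex β.right else 0

theorem leftDerivPath_mul_vertex (β : Quiver.Total V) {a b : V} (p : Quiver.Path a b) :
    leftDerivPath (K := K) β p * vertex b = leftDerivPath β p := by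
  cases p with
  | nil => exact zero_mul _
  | cons p α =>
    rw [leftDerivPath, add_mul, mul_assoc]
    congr 1
    · exact congrArg _ (arrow_mul_vertex ⟨_, _, α⟩)
    · rw [smul_mul_assoc]
      split_ifs with h
      · subst h
        rw [Stretched.vertex_mul_self]
      · rw [zero_mul]

theorem leftDerivPath_of_ne (β : Quiver.Total V) {a b : V} (p : Quiver.Path a b)
    (h : a ≠ β.left) : leftDerivPath (K := K) β p = 0 := by
  induction p with
  | nil => rfl
  | cons p α ih => simp [leftDerivPath, ih, constCoeff_ofPath, h]

theorem leftDerivPath_comp (β : Quiver.Total V) {a b c : V} (p : Quiver.Path a b)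
    (q : Quiver.Path b c) : leftDerivPath (K := K) β (p.comp q) =
      leftDerivPath β p * ofPath q + constCoeff (K := K) β.left (ofPath p) •
        leftDerivPath (K := K) β q := by
  induction q with
  | nil =>
    rw [leftDerivPath, smul_zero, add_zero]
    exact (leftDerivPath_mul_vertex β p).symm
  | cons q α ih =>
    rw [Quiver.Path.comp_cons, leftDerivPath, ih, leftDerivPath, ofPath_cons,
      ← ofPath_mul_ofPath, constCoeff_mul, add_mul, smul_add, mul_assoc, mul_smul, smul_mul_assoc,
      add_assoc]

/-- The left derivative along an arrow `β`: it sends a path `β p` to `p`, and all other paths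
to `0`. -/
def leftDeriv (β : Quiver.Total V) : PathAlgebra K V →ₗ[K] PathAlgebra K V :=
  linLift fun _ _ p => leftDerivPath β p

theorem leftDeriv_ofPath (β : Quiver.Total V) {a b : V} (p : Quiver.Path a b) :
    leftDeriv β (ofPath p : PathAlgebra K V) = leftDerivPath β p := linLift_ofPath _ p

/-- A Leibniz rule of Fox type: the first arrow of a concatenation lies in the left factor unless
that factor is trivial, and a trivial factor contributes only if it sits at the start of `β`. -/
theorem leftDeriv_mul (β : Quiver.Total V) (x y : PathAlgebra K V) :
    leftDeriv β (x * y) = leftDeriv β x * y + constCoeff β.left x • leftDeriv β y := by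
  refine bilin_ext (f := fun x y => leftDeriv β (x * y))
    (g := fun x y => leftDeriv β x * y + constCoeff β.left x • leftDeriv β y)
    (fun y => ⟨by simp [add_mul], by simp⟩) (fun y => ⟨by simp [mul_add], by simp⟩)
    (fun y => ⟨fun a b => ?_, fun a b => ?_⟩) (fun y => ⟨fun a b => ?_, fun a b => ?_⟩) ?_ x y
  · simp only [map_add, add_mul, add_smul]; abel
  · simp [mul_smul]
  · simp only [map_add, mul_add, smul_add]; abel
  · simp [smul_comm a]
  intro a b c d p q
  by_cases h : b = c
  · subst h
    simp only [ofPath_mul_ofPath, leftDeriv_ofPath, leftDerivPath_comp]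
  · simp only [ofPath_mul_ofPath_of_ne _ _ h, leftDeriv_ofPath, map_zero]
    -- For paths that cannot be composed both summands vanish: the first ends at `b ≠ c`, and the
    -- second would need `p` trivial at `β.left` and `q` starting there.
    rw [← leftDerivPath_mul_vertex, mul_assoc, vertex, ofPath_mul_ofPath_of_ne _ _ h, mul_zero,
      zero_add]
    by_cases hc : c = β.left
    · rw [constCoeff_ofPath, if_neg, zero_smul]
      rintro ⟨hp, rfl⟩
      exact h ((Quiver.Path.eq_of_length_zero p hp).symm.trans hc.symm)
    · rw [leftDerivPath_of_ne β q hc, smul_zero]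

open scoped Classical in
theorem leftDeriv_arrow (β γ : Quiver.Total V) :
    leftDeriv β (arrow γ : PathAlgebra K V) = if γ = β then vertex β.right else 0 := by
  rw [arrow, leftDeriv_ofPath, Quiver.Hom.toPath, leftDerivPath, leftDerivPath, zero_mul, zero_add,
    constCoeff_ofPath]
  split_ifs with h1 h2 h2
  · rw [one_smul]
  · rw [smul_zero]
  · subst h2; simp at h1
  · rw [smul_zero]

open scoped Classical in
theorem leftDeriv_arrow_mul (β γ : Quiver.Total V) (x : PathAlgebra K V) :
    leftDeriv β (arrow γ * x) = if γ = β then vertex β.right * x else 0 := by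
  rw [leftDeriv_mul, leftDeriv_arrow, constCoeff_arrow, zero_smul, add_zero]
  split_ifs <;> simp

theorem leftDeriv_vertex (β : Quiver.Total V) (a : V) :
    leftDeriv β (vertex a : PathAlgebra K V) = 0 := by
  rw [vertex, leftDeriv_ofPath, leftDerivPath]

theorem vertex_right_mul_leftDeriv (β : Quiver.Total V) (x : PathAlgebra K V) :
    vertex β.right * leftDeriv β x = leftDeriv β x := by
  induction x using induction_on with
  | zero => simp
  | add x y hx hy => rw [map_add, mul_add, hx, hy]
  | smul_path k a b p =>
    rw [map_smul, mul_smul_comm, leftDeriv_ofPath]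
    congr 1
    induction p with
    | nil => simp [leftDerivPath]
    | cons p α ih =>
      rw [leftDerivPath, mul_add, ← mul_assoc, ih, mul_smul_comm]
      split_ifs
      · rw [Stretched.vertex_mul_self]
      · simp

/-- A path is either trivial or has a unique first arrow. This decomposition yields all expansions
with respect to arrows. -/
theorem eq_sum_constCoeff_add_sum_leftDeriv [Fintype (Quiver.Total V)] (x : PathAlgebra K V) :
    x = ∑ a : V, constCoeff a x • vertex a + ∑ β : Quiver.Total V, arrow β * leftDeriv β x := by
  classical
  induction x using induction_on with
  | zero => simp
  | add x y hx hy =>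
    simp only [map_add, add_smul, mul_add, Finset.sum_add_distrib]
    nth_rewrite 1 [hx, hy]
    abel
  | smul_path k a b p =>
    simp only [map_smul, smul_assoc, mul_smul_comm, ← Finset.smul_sum, ← smul_add]
    congr 1
    induction p with
    | nil =>
      change vertex a = _
      simp only [leftDeriv_ofPath, leftDerivPath, mul_zero, Finset.sum_const_zero, add_zero,
        constCoeff_ofPath]
      rw [Finset.sum_eq_single a]
      · simp
      · intro c _ hc
        rw [if_neg fun h => hc h.2.symm, zero_smul]
      · simp
    | @cons c d p α ih =>
      rw [ofPath_cons]
      nth_rewrite 1 [ih]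
      simp only [constCoeff_mul, leftDeriv_mul, constCoeff_arrow, mul_zero, zero_smul,
        Finset.sum_const_zero, zero_add, mul_add, add_mul, Finset.sum_add_distrib, Finset.sum_mul,
        leftDeriv_arrow, mul_assoc]
      rw [add_comm]
      congr 1
      rw [Finset.sum_eq_single c, Finset.sum_eq_single ⟨c, d, α⟩]
      · rw [if_pos rfl, mul_smul_comm, smul_mul_assoc]
        congr 1
        exact (vertex_mul_arrow ⟨c, d, α⟩).trans (arrow_mul_vertex ⟨c, d, α⟩).symm
      · intro β _ hβ
        rw [if_neg (Ne.symm hβ), smul_zero, mul_zero]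
      · simp
      · intro e _ he
        rw [smul_mul_assoc, arrow, vertex, ofPath_mul_ofPath_of_ne _ _ he, smul_zero]
      · simp

/-! ### Powers of the arrow ideal -/

theorem mul_mem_arrowIdealPow {x y : PathAlgebra K V} {m n : ℕ} (hx : x ∈ arrowIdealPow K V m)
    (hy : y ∈ arrowIdealPow K V n) : x * y ∈ arrowIdealPow K V (m + n) := by
  induction hx using Submodule.span_induction with
  | zero => rw [zero_mul]; exact Submodule.zero_mem _
  | add x x' _ _ h h' => rw [add_mul]; exact Submodule.add_mem _ h h'
  | smul k x _ h => rw [smul_mul_assoc]; exact Submodule.smul_mem _ k h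
  | mem x hx =>
    obtain ⟨a, b, p, hp, rfl⟩ := hx
    induction hy using Submodule.span_induction with
    | zero => rw [mul_zero]; exact Submodule.zero_mem _
    | add x x' _ _ h h' => rw [mul_add]; exact Submodule.add_mem _ h h'
    | smul k x _ h => rw [mul_smul_comm]; exact Submodule.smul_mem _ k h
    | mem y hy =>
      obtain ⟨c, d, q, hq, rfl⟩ := hy
      by_cases h : b = c
      · subst h
        rw [ofPath_mul_ofPath]
        exact ofPath_mem_arrowIdealPow _ (by rw [Quiver.Path.length_comp]; lia)
      · rw [ofPath_mul_ofPath_of_ne _ _ h]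
        exact Submodule.zero_mem _

theorem pow_mem_arrowIdealPow {x : PathAlgebra K V} (hx : x ∈ arrowIdealPow K V 1) (n : ℕ) :
    x ^ n ∈ arrowIdealPow K V n := by
  induction n with
  | zero => exact mem_arrowIdealPow_zero _
  | succ n ih => rw [pow_succ]; exact mul_mem_arrowIdealPow ih hx

theorem constCoeff_eq_zero_of_mem {x : PathAlgebra K V} {m : ℕ} (hm : 1 ≤ m)
    (hx : x ∈ arrowIdealPow K V m) (a : V) : constCoeff a x = 0 := by
  induction hx using Submodule.span_induction with
  | zero => exact map_zero _
  | add x x' _ _ h h' => rw [map_add, h, h', add_zero]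
  | smul k x _ h => rw [map_smul, h, smul_zero]
  | mem x hx =>
    obtain ⟨a, b, p, hp, rfl⟩ := hx
    rw [constCoeff_ofPath, if_neg]
    lia

theorem mem_arrowIdealPow_one_iff [Fintype (Quiver.Total V)] {x : PathAlgebra K V} :
    x ∈ arrowIdealPow K V 1 ↔ ∀ a, constCoeff a x = 0 := by
  refine ⟨constCoeff_eq_zero_of_mem le_rfl, fun h => ?_⟩
  rw [eq_sum_constCoeff_add_sum_leftDeriv x]
  simp only [h, zero_smul, Finset.sum_const_zero, zero_add]
  refine Submodule.sum_mem _ fun β _ => ?_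
  have := mul_mem_arrowIdealPow (arrow_mem_arrowIdealPow β) (mem_arrowIdealPow_zero (leftDeriv β x))
  rwa [add_zero] at this

/-! ### Uniform elements -/

/-- For `x ≠ 0` the vertex chosen in `terminus` is the only possible one, since distinct vertices
are orthogonal. -/
theorem terminus_eq {x : PathAlgebra K V} {b : V} (h0 : x ≠ 0) (hb : x * vertex b = x) :
    terminus x = vertex b := by
  have h : ∃ b : V, x * vertex b = x := ⟨b, hb⟩
  rw [terminus, dif_pos h]
  by_contra hne
  apply h0
  calc x = x * vertex b * vertex h.choose := by rw [hb, h.choose_spec]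
    _ = 0 := by
      rw [mul_assoc, Stretched.vertex_mul_of_ne fun e => hne (congrArg vertex e.symm), mul_zero]

theorem IsUniform.exists_terminus_eq {x : PathAlgebra K V} (h : IsUniform x) :
    ∃ b, terminus x = vertex b ∧ x * vertex b = x := by
  obtain ⟨h0, _, b, hb⟩ := h
  exact ⟨b, terminus_eq h0 hb, hb⟩

theorem IsUniform.mul_terminus {x : PathAlgebra K V} (h : IsUniform x) : x * terminus x = x := by
  obtain ⟨b, hb, h⟩ := h.exists_terminus_eq
  rw [hb, h]

theorem IsUniform.terminus_mul_self {x : PathAlgebra K V} (h : IsUniform x) :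
    terminus x * terminus x = terminus x := by
  obtain ⟨b, hb, h⟩ := h.exists_terminus_eq
  rw [hb, Stretched.vertex_mul_self]

theorem vertex_ne_zero (a : V) : (vertex a : PathAlgebra K V) ≠ 0 := ofPath_ne_zero _

theorem arrow_ne_zero (β : Quiver.Total V) : (arrow β : PathAlgebra K V) ≠ 0 := ofPath_ne_zero _

theorem terminus_vertex (a : V) : terminus (vertex a : PathAlgebra K V) = vertex a :=
  terminus_eq (vertex_ne_zero a) (Stretched.vertex_mul_self a)

theorem terminus_arrow (β : Quiver.Total V) :
    terminus (arrow β : PathAlgebra K V) = vertex β.right :=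
  terminus_eq (arrow_ne_zero β) (arrow_mul_vertex β)

theorem isUniform_vertex (a : V) : IsUniform (vertex a : PathAlgebra K V) :=
  ⟨vertex_ne_zero a, ⟨a, Stretched.vertex_mul_self a⟩, a, Stretched.vertex_mul_self a⟩

theorem isUniform_arrow (β : Quiver.Total V) : IsUniform (arrow β : PathAlgebra K V) :=
  ⟨arrow_ne_zero β, ⟨_, vertex_mul_arrow β⟩, _, arrow_mul_vertex β⟩

theorem vertex_injective : Function.Injective (vertex : V → PathAlgebra K V) := by
  intro a b h
  by_contra hne
  apply vertex_ne_zero (K := K) a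
  rw [← Stretched.vertex_mul_self, ← Stretched.vertex_mul_of_ne hne]
  congr 1

theorem arrow_injective : Function.Injective (arrow : Quiver.Total V → PathAlgebra K V) := by
  classical
  intro β γ h
  by_contra hne
  apply vertex_ne_zero (K := K) β.right
  have := leftDeriv_arrow (K := K) β γ
  rwa [← h, leftDeriv_arrow, if_pos rfl, if_neg (Ne.symm hne)] at this

/-! ### Right independent sets -/

/-- The right ideals generated by the elements `y ∈ G` are independent, and each of them is
isomorphic to `𝔱(y)K𝒬`. -/
def RightIndependent (G : Finset (PathAlgebra K V)) : Prop :=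
  ∀ c : PathAlgebra K V → PathAlgebra K V, (∀ y ∈ G, terminus y * c y = c y) →
    ∑ y ∈ G, y * c y = 0 → ∀ y ∈ G, c y = 0

theorem RightIndependent.unique {G : Finset (PathAlgebra K V)} (h : RightIndependent G)
    {x : PathAlgebra K V} {c d : PathAlgebra K V → PathAlgebra K V} (hc : IsExpansion G x c)
    (hd : IsExpansion G x d) : ∀ y ∈ G, c y = d y := by
  intro y hy
  refine sub_eq_zero.1 (h (fun y => c y - d y) (fun y hy => ?_) ?_ y hy)
  · rw [mul_sub, hc.1 y hy, hd.1 y hy]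
  · simp only [mul_sub, Finset.sum_sub_distrib]
    rw [← hc.2, ← hd.2, sub_self]

/-- A relation can be added to an expansion, so uniqueness for a single `x` already forces
independence. This is why independence of a set of the resolution is only available when the next
set is nonempty. -/
theorem rightIndependent_of_unique {G : Finset (PathAlgebra K V)} {x : PathAlgebra K V}
    {d : PathAlgebra K V → PathAlgebra K V} (hd : IsExpansion G x d)
    (h : ∀ c, IsExpansion G x c → ∀ y ∈ G, c y = d y) : RightIndependent G := by
  intro c hc h0 y hy
  have := h (fun y => d y + c y) ⟨fun y hy => ?_, ?_⟩ y hy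
  · simpa using this
  · rw [mul_add, hd.1 y hy, hc y hy]
  · simp only [mul_add, Finset.sum_add_distrib]
    rw [h0, add_zero]
    exact hd.2

theorem rightIndependent_vertices {G : Finset (PathAlgebra K V)}
    (hG : (G : Set (PathAlgebra K V)) = Set.range vertex) : RightIndependent G := by
  intro c hc h0 y hy
  have hv : ∀ y ∈ G, ∃ a, vertex a = y := fun y hy => by
    have : y ∈ (G : Set (PathAlgebra K V)) := hy
    rwa [hG] at this
  obtain ⟨a, rfl⟩ := hv y hy
  have h1 : vertex a * ∑ y ∈ G, y * c y = vertex a * c (vertex a) := by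
    rw [Finset.mul_sum, Finset.sum_eq_single (vertex a)]
    · rw [← mul_assoc, Stretched.vertex_mul_self]
    · intro z hz hne
      obtain ⟨b, rfl⟩ := hv z hz
      rw [← mul_assoc, Stretched.vertex_mul_of_ne, zero_mul]
      rintro rfl
      exact hne rfl
    · exact fun h => (h hy).elim
  rw [← hc _ hy, terminus_vertex, ← h1, h0, mul_zero]

/-- The derivative along `β` reads off the coefficient at `β`, which makes the arrows right
independent. -/
theorem leftDeriv_sum_arrows {G : Finset (PathAlgebra K V)}
    (hG : (G : Set (PathAlgebra K V)) = Set.range arrow) (c : PathAlgebra K V → PathAlgebra K V)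
    (β : Quiver.Total V) :
    leftDeriv β (∑ y ∈ G, y * c y) = vertex β.right * c (arrow β) := by
  classical
  have hβ : arrow β ∈ G := by
    rw [← Finset.mem_coe, hG]
    exact ⟨β, rfl⟩
  rw [map_sum, Finset.sum_eq_single (arrow β), leftDeriv_arrow_mul, if_pos rfl]
  · intro z hz hne
    rw [← Finset.mem_coe, hG] at hz
    obtain ⟨γ, rfl⟩ := hz
    rw [leftDeriv_arrow_mul, if_neg]
    rintro rfl
    exact hne rfl
  · exact fun h => (h hβ).elim

theorem rightIndependent_arrows {G : Finset (PathAlgebra K V)}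
    (hG : (G : Set (PathAlgebra K V)) = Set.range arrow) : RightIndependent G := by
  intro c hc h0 y hy
  have hy' := hy
  rw [← Finset.mem_coe, hG] at hy'
  obtain ⟨β, rfl⟩ := hy'
  rw [← hc _ hy, terminus_arrow, ← leftDeriv_sum_arrows hG c β, h0, map_zero]

end PathAlgebra

namespace Stretched

variable {A : ℕ} {V : Type u} [Quiver.{v} V]

/-! ### The contraction of the stretched quiver -/

/-- The vertex of `𝒬` from which a vertex of the stretched quiver is reached without passing another
vertex of `𝒬`. -/
def base : Stretched A V → V := Sum.elim id fun q => q.1.left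

/-- A vertex of the stretched quiver that is not a vertex of `𝒬`. -/
def new (α : Quiver.Total V) (j : Fin (A - 1)) : Stretched A V := Sum.inr (α, j)

theorem pt_zero (α : Quiver.Total V) : pt (A := A) α 0 = old α.left := rfl

theorem pt_last (hA : 1 ≤ A) (α : Quiver.Total V) : pt (A := A) α A = old α.right :=
  (if_neg (by lia)).trans (dif_neg (by lia))

theorem pt_succ (α : Quiver.Total V) {j : ℕ} (hj : j < A - 1) :
    pt (A := A) α (j + 1) = new α ⟨j, hj⟩ :=
  (if_neg (by lia)).trans (dif_pos (by lia))

theorem eq_old_or_eq_pt (x : Stretched A V) :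
    (∃ a, x = old a) ∨ ∃ (α : Quiver.Total V) (j : ℕ), j + 1 < A ∧ x = pt α (j + 1) := by
  rcases x with a | ⟨α, j⟩
  · exact .inl ⟨a, rfl⟩
  · exact .inr ⟨α, j, by lia, (pt_succ α j.2).symm⟩

theorem old_ne_pt_succ (a : V) (α : Quiver.Total V) {j : ℕ} (hj : j + 1 < A) :
    old a ≠ pt (A := A) α (j + 1) := by
  rw [pt_succ α (by lia)]
  exact Sum.inl_ne_inr

theorem old_injective : Function.Injective (old : V → Stretched A V) := Sum.inl_injective

theorem base_pt (α : Quiver.Total V) {j : ℕ} (hj : j < A) : base (pt (A := A) α j) = α.left := by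
  cases j with
  | zero => rfl
  | succ j => rw [pt_succ α (by lia)]; rfl

/-- The path `α₁ ⋯ α_j`. -/
def initialPath (α : Quiver.Total V) :
    ∀ j : ℕ, j ≤ A → Quiver.Path (pt (A := A) α 0) (pt (A := A) α j)
  | 0, _ => .nil
  | j + 1, h => (initialPath α j (Nat.le_of_succ_le h)).cons ⟨(α, ⟨j, h⟩), rfl, rfl⟩

/-- The number of the arrows of the path from `base x` to `x`. -/
def position : Stretched A V → ℕ := Sum.elim (fun _ => 0) fun q => q.2 + 1

theorem position_old (a : V) : position (old a : Stretched A V) = 0 := rfl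

theorem position_pt (α : Quiver.Total V) {j : ℕ} (hj : j < A) : position (pt (A := A) α j) = j := by
  cases j with
  | zero => rfl
  | succ j => rw [pt_succ α (by lia)]; rfl

theorem position_lt (hA : 1 ≤ A) (x : Stretched A V) : position x < A := by
  rcases eq_old_or_eq_pt x with ⟨a, rfl⟩ | ⟨α, j, hj, rfl⟩
  · rw [position_old]; lia
  · rwa [position_pt α hj]

theorem arr_injective {α γ : Quiver.Total V} {i j : Fin A} (h : arr α i = arr γ j) : α = γ :=
  congrArg (fun β : Quiver.Total (Stretched A V) => β.hom.1.1) h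

variable {K : Type w} [Field K]

/-- The path from `base x` to `x` that does not pass another vertex of `𝒬`. -/
def stub : Stretched A V → PathAlgebra K (Stretched A V)
  | .inl a => PathAlgebra.vertex (old a)
  | .inr (α, j) => PathAlgebra.ofPath (initialPath (A := A) α (j + 1) (by lia))

theorem stub_old (a : V) : stub (K := K) (A := A) (old a) = PathAlgebra.vertex (old a) := rfl

theorem stub_pt (α : Quiver.Total V) {j : ℕ} (hj : j < A) :
    stub (K := K) (A := A) (pt α j) = PathAlgebra.ofPath (initialPath α j hj.le) := by
  cases j with
  | zero => rfl
  | succ j => exact congrArg stub (pt_succ α (j := j) (by lia))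

theorem stub_mul_vertex (x : Stretched A V) :
    stub (K := K) x * PathAlgebra.vertex x = stub x := by
  rcases eq_old_or_eq_pt x with ⟨a, rfl⟩ | ⟨α, j, hj, rfl⟩
  · exact PathAlgebra.ofPath_mul_vertex _
  · rw [stub_pt α hj, PathAlgebra.ofPath_mul_vertex]

theorem vertex_mul_stub_pt (α : Quiver.Total V) {j : ℕ} (hj : j < A) :
    PathAlgebra.vertex (old α.left) * stub (K := K) (A := A) (pt α j) = stub (pt α j) := by
  rw [stub_pt α hj]
  exact PathAlgebra.vertex_mul_ofPath _

open scoped Classical in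
/-- The image of an arrow under the contraction `α_A ↦ α` and `α_i ↦ 𝔬(α)` for `i < A`. -/
def contractArrow {x y : Stretched A V} (β : x ⟶ y) : PathAlgebra K V :=
  if (β.1.2 : ℕ) + 1 = A then PathAlgebra.arrow β.1.1 else PathAlgebra.vertex β.1.1.left

/-- The image of a path under the contraction `α_A ↦ α` and `α_i ↦ 𝔬(α)` for `i < A`. -/
def contractPath {x : Stretched A V} :
    ∀ {y : Stretched A V}, Quiver.Path x y → PathAlgebra K V
  | _, .nil => PathAlgebra.vertex (base x)
  | _, .cons p β => contractPath p * contractArrow β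

variable [Fintype V]

theorem contractArrow_mul_vertex {x y : Stretched A V} (β : x ⟶ y) :
    contractArrow (K := K) β * PathAlgebra.vertex (base y) = contractArrow β := by
  obtain ⟨⟨α, i⟩, rfl, rfl⟩ := β
  simp only [contractArrow]
  split_ifs with h
  · have : base (pt (A := A) α (i + 1)) = α.right := by
      rw [h, pt_last (by lia)]
      rfl
    rw [this, PathAlgebra.arrow_mul_vertex]
  · rw [base_pt α (by lia), vertex_mul_self]

theorem contractPath_mul_vertex {x y : Stretched A V} (p : Quiver.Path x y) :
    contractPath (K := K) p * PathAlgebra.vertex (base y) = contractPath p := by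
  cases p with
  | nil => exact vertex_mul_self _
  | cons p β => rw [contractPath, mul_assoc, contractArrow_mul_vertex]

theorem vertex_mul_contractPath {x y : Stretched A V} (p : Quiver.Path x y) :
    PathAlgebra.vertex (base x) * contractPath (K := K) p = contractPath p := by
  induction p with
  | nil => exact vertex_mul_self _
  | cons p β ih => rw [contractPath, ← mul_assoc, ih]

theorem contractPath_comp {x y z : Stretched A V} (p : Quiver.Path x y) (q : Quiver.Path y z) :
    contractPath (K := K) (p.comp q) = contractPath p * contractPath q := by
  induction q with
  | nil => exact (contractPath_mul_vertex p).symm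
  | cons q β ih => rw [Quiver.Path.comp_cons, contractPath, ih, contractPath, mul_assoc]

theorem contractPath_initialPath_of_lt (α : Quiver.Total V) {j : ℕ} (hj : j < A) :
    contractPath (K := K) (initialPath (A := A) α j hj.le) = PathAlgebra.vertex α.left := by
  induction j with
  | zero => rfl
  | succ j ih =>
    rw [initialPath, contractPath, ih (by lia), contractArrow, if_neg (by simp; lia),
      vertex_mul_self]

theorem contractPath_initialPath (hA : 1 ≤ A) (α : Quiver.Total V) :
    contractPath (K := K) (initialPath (A := A) α A le_rfl) = PathAlgebra.arrow α := by
  obtain ⟨j, rfl⟩ := Nat.exists_eq_add_of_le' hA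
  rw [initialPath, contractPath, contractPath_initialPath_of_lt α (Nat.lt_succ_self j),
    contractArrow, if_pos rfl]
  exact PathAlgebra.vertex_mul_arrow α

/-! ### Factoring paths through θ* and stubs -/

variable [Fintype (Quiver.Total V)]

theorem vertex_mul_prod_arrow (α : Quiver.Total V) {j : ℕ} (hj : j ≤ A) :
    PathAlgebra.vertex (old α.left) *
      (List.ofFn fun i : Fin j => PathAlgebra.arrow (K := K) (arr (A := A) α
        (Fin.castLE hj i))).prod = PathAlgebra.ofPath (initialPath α j hj) := by
  induction j with
  | zero => simp [initialPath, PathAlgebra.vertex, pt_zero]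
  | succ j ih =>
    have := ih (by lia)
    rw [List.ofFn_succ', List.concat_eq_append, List.prod_append, ← mul_assoc, initialPath,
      PathAlgebra.ofPath_cons, ← this, List.prod_singleton]
    rfl

theorem thetaArrow_eq (hA : 1 ≤ A) (α : Quiver.Total V) :
    thetaArrow (K := K) A α = PathAlgebra.ofPath (initialPath α A le_rfl) := by
  have h := vertex_mul_prod_arrow (K := K) α (le_refl A)
  simp only [Fin.castLE_rfl, id] at h
  rw [thetaArrow, h]
  rw [← pt_last hA]
  exact PathAlgebra.ofPath_mul_vertex _

theorem theta_ofPath {a b : V} (p : Quiver.Path a b) :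
    theta K A V (PathAlgebra.ofPath p) = thetaPath A p := PathAlgebra.linLift_ofPath _ p

theorem theta_vertex (a : V) :
    theta K A V (PathAlgebra.vertex a) = PathAlgebra.vertex (old a) := theta_ofPath _

theorem theta_arrow (α : Quiver.Total V) :
    theta K A V (PathAlgebra.arrow α) = thetaArrow A α := by
  rw [PathAlgebra.arrow, theta_ofPath, Quiver.Hom.toPath, thetaPath, thetaPath, thetaArrow,
    ← mul_assoc, ← mul_assoc, vertex_mul_self]

/-- Appending an arrow either lengthens the stub, and the contracted arrow is a vertex, or completes
it to α₁⋯α_A = θ*(α), and the remaining stub is trivial. -/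
theorem stub_mul_arrow {x y : Stretched A V} (β : x ⟶ y) :
    stub x * PathAlgebra.arrow ⟨x, y, β⟩ = theta K A V (contractArrow β) * stub y := by
  obtain ⟨⟨α, i⟩, rfl, rfl⟩ := β
  have hi := i.2
  -- The endpoint of the path depends on `j`, so `i + 1 = A` cannot be rewritten in place; a general
  -- `j` allows substitution.
  have : ∀ (j : ℕ) (hj : j ≤ A), j = A → PathAlgebra.ofPath (K := K) (initialPath α j hj) =
      PathAlgebra.ofPath (initialPath α A le_rfl) := by
    rintro j hj rfl
    rfl
  have h1 : stub (pt α i) * PathAlgebra.arrow (K := K) (arr α i) =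
      PathAlgebra.ofPath (initialPath (A := A) α (i + 1) (by lia)) := by
    rw [stub_pt α hi]
    exact (PathAlgebra.ofPath_cons _ _).symm
  refine h1.trans ?_
  simp only [contractArrow]
  split_ifs with h
  · have h2 : PathAlgebra.ofPath (initialPath (A := A) α (i + 1) (by lia)) =
        thetaArrow (K := K) A α := by
      rw [thetaArrow_eq (by lia)]
      exact this _ _ h
    rw [theta_arrow, h2]
    have h3 : pt (A := A) α (i + 1) = old α.right := by rw [h, pt_last (by lia)]
    rw [h3, stub_old, thetaArrow, mul_assoc (_ * _) (PathAlgebra.vertex _), vertex_mul_self]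
  · rw [theta_vertex, vertex_mul_stub_pt α (by lia), stub_pt α (by lia)]

theorem stub_mul_ofPath {x y : Stretched A V} (p : Quiver.Path x y) :
    stub x * PathAlgebra.ofPath p = theta K A V (contractPath p) * stub y := by
  induction p with
  | nil =>
    rw [contractPath, theta_vertex]
    refine (stub_mul_vertex x).trans ?_
    rcases eq_old_or_eq_pt x with ⟨a, rfl⟩ | ⟨α, j, hj, rfl⟩
    · exact (vertex_mul_self _).symm
    · rw [base_pt α hj, vertex_mul_stub_pt α hj]
  | cons p β ih =>
    rw [PathAlgebra.ofPath_cons, ← mul_assoc, ih, mul_assoc, stub_mul_arrow, ← mul_assoc,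
      ← map_mul, contractPath]

/-! ### The coordinates of the elements of `θ*(1)K𝒬̃` -/

open scoped Classical in
/-- The part of an element of `K𝒬̃` that consists of paths from a vertex of `𝒬` to `x`, as an element
of `K𝒬`. -/
def coord (x : Stretched A V) : PathAlgebra K (Stretched A V) →ₗ[K] PathAlgebra K V :=
  PathAlgebra.linLift fun y z p => if (∃ a, y = old a) ∧ z = x then contractPath p else 0

open scoped Classical in
theorem coord_ofPath (x : Stretched A V) {y z : Stretched A V} (p : Quiver.Path y z) :
    coord (K := K) x (PathAlgebra.ofPath p) =
      if (∃ a, y = old a) ∧ z = x then contractPath p else 0 :=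
  PathAlgebra.linLift_ofPath _ p

theorem coord_ofPath_comp (x : Stretched A V) {y z t : Stretched A V} (p : Quiver.Path y z)
    (q : Quiver.Path z t) (hy : ∃ a, y = old a) (hz : ∃ b, z = old b) :
    coord (K := K) x (PathAlgebra.ofPath (p.comp q)) =
      contractPath p * coord x (PathAlgebra.ofPath q) := by
  rw [coord_ofPath, coord_ofPath, contractPath_comp]
  by_cases h : t = x <;> simp [h, hy, hz]

theorem mul_coord_ofPath_of_ne (x : Stretched A V) {a b : V} {y z : Stretched A V}
    (p : Quiver.Path a b) (q : Quiver.Path y z) (h : old b ≠ y) :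
    PathAlgebra.ofPath p * coord (K := K) x (PathAlgebra.ofPath q) = 0 := by
  rw [coord_ofPath]
  split_ifs with hq
  · obtain ⟨⟨c, rfl⟩, _⟩ := hq
    rw [← vertex_mul_contractPath, ← mul_assoc, PathAlgebra.vertex,
      PathAlgebra.ofPath_mul_ofPath_of_ne, zero_mul]
    rintro rfl
    exact h rfl
  · exact mul_zero _

theorem coord_theta_arrow_mul (hA : 1 ≤ A) (x : Stretched A V) (α : Quiver.Total V)
    (z : PathAlgebra K (Stretched A V)) :
    coord x (theta K A V (PathAlgebra.arrow α) * z) = PathAlgebra.arrow α * coord x z := by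
  induction z using PathAlgebra.induction_on with
  | zero => simp
  | add y z hy hz => simp only [map_add, mul_add, hy, hz]
  | smul_path k y z p =>
    simp only [map_smul, mul_smul_comm]
    congr 1
    rw [theta_arrow, thetaArrow_eq hA]
    by_cases h : pt α A = y
    · subst h
      rw [PathAlgebra.ofPath_mul_ofPath]
      exact (coord_ofPath_comp x (initialPath α A le_rfl) p ⟨_, pt_zero α⟩
        ⟨_, pt_last hA α⟩).trans (congrArg (· * _) (contractPath_initialPath hA α))
    · rw [PathAlgebra.ofPath_mul_ofPath_of_ne _ _ h, map_zero, PathAlgebra.arrow,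
        mul_coord_ofPath_of_ne]
      rwa [pt_last hA] at h

/-- Contraction is multiplicative on paths between old vertices and undoes θ*, so `coord x` is left
K𝒬-linear. -/
theorem coord_theta_mul (hA : 1 ≤ A) (x : Stretched A V) (a : PathAlgebra K V)
    (z : PathAlgebra K (Stretched A V)) : coord x (theta K A V a * z) = a * coord x z := by
  induction a using PathAlgebra.induction_on generalizing z with
  | zero => simp
  | add y z hy hz => simp only [map_add, add_mul, hy, hz]
  | smul_path k a b p =>
    simp only [map_smul, smul_mul_assoc]
    congr 1
    induction p generalizing z with
    | nil =>
      induction z using PathAlgebra.induction_on with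
      | zero => simp
      | add y z hy hz => simp only [map_add, mul_add, hy, hz]
      | smul_path k y z p =>
        simp only [map_smul, mul_smul_comm]
        congr 1
        rw [theta_ofPath, thetaPath, PathAlgebra.vertex]
        by_cases h : old a = y
        · subst h
          rw [PathAlgebra.ofPath_mul_ofPath, coord_ofPath_comp x _ p ⟨_, rfl⟩ ⟨_, rfl⟩]
          rfl
        · rw [PathAlgebra.ofPath_mul_ofPath_of_ne _ _ h, map_zero, mul_coord_ofPath_of_ne x _ p h]
    | cons p α ih =>
      rw [PathAlgebra.ofPath_cons, map_mul (theta K A V), mul_assoc, ih,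
        coord_theta_arrow_mul hA, mul_assoc]

/-- The left factor removes the paths that start at new vertices. Each remaining path has exactly
one nonzero coordinate, at its endpoint, and `stub_mul_ofPath` recovers the path from it. -/
theorem theta_one_mul (z : PathAlgebra K (Stretched A V)) :
    theta K A V 1 * z = ∑ x, theta K A V (coord x z) * stub x := by
  classical
  induction z using PathAlgebra.induction_on with
  | zero => simp
  | add y z hy hz => simp only [map_add, mul_add, add_mul, Finset.sum_add_distrib, hy, hz]
  | smul_path k y z p =>
    simp only [map_smul, smul_mul_assoc, mul_smul_comm, ← Finset.smul_sum]
    congr 1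
    rw [Finset.sum_eq_single z, coord_ofPath]
    · rcases eq_old_or_eq_pt y with ⟨a, rfl⟩ | ⟨α, j, hj, rfl⟩
      · rw [if_pos ⟨⟨a, rfl⟩, rfl⟩, ← stub_mul_ofPath, PathAlgebra.one_def, map_sum,
          Finset.sum_mul, Finset.sum_eq_single a]
        · rw [theta_vertex]; rfl
        · intro b _ hb
          rw [theta_vertex, PathAlgebra.vertex, PathAlgebra.ofPath_mul_ofPath_of_ne]
          exact fun e => hb (old_injective e)
        · simp
      · rw [if_neg, map_zero, zero_mul, PathAlgebra.one_def, map_sum, Finset.sum_mul]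
        · refine Finset.sum_eq_zero fun a _ => ?_
          rw [theta_vertex, PathAlgebra.vertex, PathAlgebra.ofPath_mul_ofPath_of_ne]
          exact old_ne_pt_succ a α hj
        · rintro ⟨⟨a, h⟩, -⟩
          exact old_ne_pt_succ a α hj h.symm
    · intro y _ hy
      rw [coord_ofPath, if_neg fun h => hy h.2.symm, map_zero, zero_mul]
    · simp

theorem theta_one_mul_theta (a : PathAlgebra K V) :
    theta K A V 1 * theta K A V a = theta K A V a := by
  rw [← map_mul, one_mul]

theorem theta_mul_theta_one (a : PathAlgebra K V) :
    theta K A V a * theta K A V 1 = theta K A V a := by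
  rw [← map_mul, mul_one]

/-- The corner eK𝒬̃e is θ*(K𝒬): among the stubs only those at old vertices survive multiplication by
e on the right, and these are vertices. -/
theorem exists_theta_eq (z : PathAlgebra K (Stretched A V)) :
    ∃ a, theta K A V 1 * z * theta K A V 1 = theta K A V a := by
  have h : ∀ x : Stretched A V, ∃ b, stub x * theta K A V 1 = theta K A V b := by
    intro x
    rcases eq_old_or_eq_pt x with ⟨a, rfl⟩ | ⟨α, j, hj, rfl⟩
    · refine ⟨PathAlgebra.vertex a, ?_⟩
      rw [← theta_mul_theta_one (PathAlgebra.vertex a), theta_vertex]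
      rfl
    · refine ⟨0, ?_⟩
      rw [← stub_mul_vertex, PathAlgebra.one_def, map_sum, mul_assoc, Finset.mul_sum,
        Finset.sum_eq_zero, map_zero, mul_zero]
      intro a _
      rw [theta_vertex, vertex_mul_of_ne]
      exact (old_ne_pt_succ a α hj).symm
  choose b hb using h
  refine ⟨∑ x, coord x z * b x, ?_⟩
  rw [theta_one_mul, Finset.sum_mul, map_sum]
  refine Finset.sum_congr rfl fun x _ => ?_
  rw [mul_assoc, hb, map_mul]

theorem theta_injective (hA : 1 ≤ A) : Function.Injective (theta K A V) := by
  rw [injective_iff_map_eq_zero]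
  intro a ha
  rw [← mul_one a, PathAlgebra.one_def, Finset.mul_sum]
  refine Finset.sum_eq_zero fun b _ => ?_
  -- The coordinate of `vertex (old b)` at `old b` is `vertex b`, so this coordinate recovers `a *
  -- vertex b` from θ*(a).
  have h := coord_theta_mul (K := K) hA (old b) a (PathAlgebra.vertex (old b))
  rw [ha, zero_mul, map_zero, PathAlgebra.vertex, coord_ofPath, if_pos ⟨⟨b, rfl⟩, rfl⟩] at h
  exact h.symm

/-! ### The stretched ideal -/

theorem theta_mem_ideal {S : Set (PathAlgebra K V)} {a : PathAlgebra K V}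
    (h : a ∈ TwoSidedIdeal.span S) : theta K A V a ∈ ideal A S := by
  rw [TwoSidedIdeal.mem_span_iff_mem_addSubgroup_closure] at h
  induction h using AddSubgroup.closure_induction with
  | mem a h =>
    obtain ⟨_, ⟨b, -, x, hx, rfl⟩, c, -, rfl⟩ := h
    simp only [map_mul]
    exact TwoSidedIdeal.mul_mem_right _ _ _ (TwoSidedIdeal.mul_mem_left _ _ _
      (TwoSidedIdeal.subset_span ⟨x, hx, rfl⟩))
  | zero => rw [map_zero]; exact TwoSidedIdeal.zero_mem _
  | add a b _ _ ha hb => rw [map_add]; exact TwoSidedIdeal.add_mem _ ha hb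
  | neg a _ ha => rw [map_neg]; exact TwoSidedIdeal.neg_mem _ ha

/-- Coordinates ignore a factor e on the left, and θ*(s) = eθ*(s). In a generator bθ*(s)c the factor
b may thus be replaced by ebe = θ*(b'), and linearity leaves b' s times a coordinate of c. -/
theorem coord_mem_span (hA : 1 ≤ A) {S : Set (PathAlgebra K V)}
    {z : PathAlgebra K (Stretched A V)} (h : z ∈ ideal A S) (x : Stretched A V) :
    coord x z ∈ TwoSidedIdeal.span S := by
  rw [ideal, TwoSidedIdeal.mem_span_iff_mem_addSubgroup_closure] at h
  induction h using AddSubgroup.closure_induction with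
  | mem a h =>
    obtain ⟨_, ⟨b, -, _, ⟨s, hs, rfl⟩, rfl⟩, c, -, rfl⟩ := h
    obtain ⟨b', hb'⟩ := exists_theta_eq b
    have : coord x (b * theta K A V s * c) = b' * s * coord x c := by
      rw [← one_mul (coord x (b * theta K A V s * c)), ← coord_theta_mul hA,
        ← theta_one_mul_theta s]
      simp only [← mul_assoc]
      rw [hb', ← map_mul, coord_theta_mul hA]
    change coord x (b * theta K A V s * c) ∈ _
    rw [this]
    exact TwoSidedIdeal.mul_mem_right _ _ _ (TwoSidedIdeal.mul_mem_left _ _ _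
      (TwoSidedIdeal.subset_span hs))
  | zero => rw [map_zero]; exact TwoSidedIdeal.zero_mem _
  | add a b _ _ ha hb => rw [map_add]; exact TwoSidedIdeal.add_mem _ ha hb
  | neg a _ ha => rw [map_neg]; exact TwoSidedIdeal.neg_mem _ ha

theorem theta_mem_ideal_iff (hA : 1 ≤ A) {S : Set (PathAlgebra K V)} {a : PathAlgebra K V} :
    theta K A V a ∈ ideal A S ↔ a ∈ TwoSidedIdeal.span S := by
  refine ⟨fun h => ?_, theta_mem_ideal⟩
  rw [← mul_one a, PathAlgebra.one_def, Finset.mul_sum]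
  refine sum_mem fun b _ => ?_
  have h := coord_mem_span hA (TwoSidedIdeal.mul_mem_right _ _ (PathAlgebra.vertex (old b)) h)
    (old b)
  rw [coord_theta_mul hA, PathAlgebra.vertex, coord_ofPath, if_pos ⟨⟨b, rfl⟩, rfl⟩] at h
  exact h

theorem theta_one_mul_stub_old (a : V) :
    theta K A V 1 * stub (old a) = PathAlgebra.vertex (old a) := by
  rw [stub_old, ← theta_vertex, theta_one_mul_theta]

/-- If a path passes `ℓ > 0` of the last arrows `α_A`, then it is divisible by the image under `θ*` of
a path of length `ℓ - 1`. -/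
theorem exists_ofPath_eq_mul {x y : Stretched A V} (p : Quiver.Path x y) :
    ∃ ℓ : ℕ, position x + p.length = A * ℓ + position y ∧ (ℓ ≠ 0 →
      ∃ u : PathAlgebra K (Stretched A V), ∃ m ∈ PathAlgebra.arrowIdealPow K V (ℓ - 1),
        PathAlgebra.ofPath p = u * theta K A V m * stub y) := by
  induction p with
  | nil => exact ⟨0, by simp, fun h => (h rfl).elim⟩
  | @cons y z p β ih =>
    obtain ⟨ℓ, hℓ, h⟩ := ih
    have hs := stub_mul_arrow (K := K) β
    have step : ∀ (u : PathAlgebra K (Stretched A V)) (m : PathAlgebra K V),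
        PathAlgebra.ofPath p = u * theta K A V m * stub y → PathAlgebra.ofPath (p.cons β) =
          u * theta K A V (m * contractArrow β) * stub z := by
      intro u m e
      rw [PathAlgebra.ofPath_cons, e, mul_assoc, hs, map_mul]
      simp only [mul_assoc]
    obtain ⟨⟨α, i⟩, rfl, rfl⟩ := β
    have hi := i.2
    rw [position_pt α hi] at hℓ
    by_cases hA : (i : ℕ) + 1 = A
    · have hr : pt (A := A) α (i + 1) = old α.right := by rw [hA, pt_last (by lia)]
      refine ⟨ℓ + 1, ?_, fun _ => ?_⟩
      · simp only [hr, position_old, Quiver.Path.length_cons, mul_add]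
        lia
      -- At the first completed arrow the whole path is absorbed into `u` with `m = 1`; this
      -- accounts for the exponent `ℓ - 1`.
      · by_cases h0 : ℓ = 0
        · refine ⟨PathAlgebra.ofPath (p.cons ⟨(α, i), rfl, rfl⟩), 1,
            by subst h0; exact PathAlgebra.mem_arrowIdealPow_zero _, ?_⟩
          rw [mul_assoc]
          simp only [hr]
          rw [theta_one_mul_stub_old, ← hr, PathAlgebra.ofPath_mul_vertex]
        · obtain ⟨u, m, hm, e⟩ := h h0
          refine ⟨u, _, ?_, step u m e⟩
          simp only [contractArrow, if_pos hA]
          have := PathAlgebra.mul_mem_arrowIdealPow hm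
            (PathAlgebra.arrow_mem_arrowIdealPow (K := K) α)
          rwa [Nat.sub_add_cancel (by lia)] at this
    · refine ⟨ℓ, ?_, fun h0 => ?_⟩
      · rw [position_pt α (by simp; lia)]
        simp only [Quiver.Path.length_cons]
        lia
      · obtain ⟨u, m, hm, e⟩ := h h0
        refine ⟨u, _, ?_, step u m e⟩
        have := PathAlgebra.mul_mem_arrowIdealPow hm
          (PathAlgebra.mem_arrowIdealPow_zero (contractArrow (K := K) (A := A)
            (x := pt α i) (y := pt α (i + 1)) ⟨(α, i), rfl, rfl⟩))
        rwa [add_zero] at this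

theorem arrowIdealPow_subset_ideal (hA : 1 ≤ A) {S : Set (PathAlgebra K V)} {N : ℕ}
    (hN : ∀ x ∈ PathAlgebra.arrowIdealPow K V N, x ∈ TwoSidedIdeal.span S) :
    ∀ x ∈ PathAlgebra.arrowIdealPow K (Stretched A V) (A * (N + 2)), x ∈ ideal A S := by
  have hmono : ∀ m, N ≤ m → ∀ x ∈ PathAlgebra.arrowIdealPow K V m, x ∈ TwoSidedIdeal.span S := by
    intro m hm x hx
    refine hN x (Submodule.span_mono ?_ hx)
    rintro _ ⟨a, b, p, hp, rfl⟩
    exact ⟨a, b, p, hm.trans hp, rfl⟩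
  intro x hx
  induction hx using Submodule.span_induction with
  | zero => exact TwoSidedIdeal.zero_mem _
  | add x x' _ _ h h' => exact TwoSidedIdeal.add_mem _ h h'
  | smul k x _ h =>
    rw [Algebra.smul_def]
    exact TwoSidedIdeal.mul_mem_left _ _ _ h
  | mem x hx =>
    obtain ⟨a, b, p, hp, rfl⟩ := hx
    obtain ⟨ℓ, hℓ, h⟩ := exists_ofPath_eq_mul (K := K) p
    have hb := position_lt hA b
    -- Since `position b < A`, a path of this length passes more than `N` last arrows, so the factor
    -- `m` lies in the `N`-th power of the arrow ideal.
    have : A * (N + 1) < A * (ℓ + 1) := by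
      simp only [mul_add] at *
      lia
    have := Nat.lt_of_mul_lt_mul_left this
    obtain ⟨u, m, hm, e⟩ := h (by lia)
    rw [e]
    exact TwoSidedIdeal.mul_mem_right _ _ _ (TwoSidedIdeal.mul_mem_left _ _ _
      (theta_mem_ideal (hmono _ (by lia) m hm)))

/-! ### Left cancellation modulo the stretched ideal -/

/-- For `i ≠ 0` the arrow starts at a new vertex, whereas all paths occurring in eK𝒬̃ start at old
ones. -/
theorem leftDeriv_theta_one_mul {α : Quiver.Total V} {i : Fin A} (hi : (i : ℕ) ≠ 0)
    (z : PathAlgebra K (Stretched A V)) :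
    PathAlgebra.constCoeff (pt α i) (theta K A V 1) = 0 ∧
      PathAlgebra.leftDeriv (arr α i) (theta K A V 1 * z) = 0 := by
  have h1 : PathAlgebra.constCoeff (K := K) (pt α i) (theta K A V 1) = 0 := by
    rw [PathAlgebra.one_def, map_sum, map_sum]
    refine Finset.sum_eq_zero fun a _ => ?_
    rw [theta_vertex, PathAlgebra.vertex, PathAlgebra.constCoeff_ofPath, if_neg]
    obtain ⟨j, hj⟩ := Nat.exists_eq_succ_of_ne_zero hi
    rw [hj]
    exact fun h => old_ne_pt_succ a α (by lia) h.2
  refine ⟨h1, ?_⟩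
  rw [PathAlgebra.leftDeriv_mul]
  rw [show (arr α i).left = pt α i from rfl, h1, zero_smul, add_zero, PathAlgebra.one_def, map_sum,
    map_sum]
  simp only [theta_vertex, PathAlgebra.leftDeriv_vertex, Finset.sum_const_zero, zero_mul]

/-- On a generator bθ*(s)c the Leibniz rule leaves only the term that differentiates b, which is
still in the ideal; the other term vanishes because θ*(s) starts at old vertices. -/
theorem leftDeriv_mem_ideal {S : Set (PathAlgebra K V)} {α : Quiver.Total V} {i : Fin A}
    (hi : (i : ℕ) ≠ 0) {z : PathAlgebra K (Stretched A V)} (hz : z ∈ ideal A S) :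
    PathAlgebra.leftDeriv (arr α i) z ∈ ideal A S := by
  have hz' := hz
  rw [ideal, TwoSidedIdeal.mem_span_iff_mem_addSubgroup_closure] at hz'
  induction hz' using AddSubgroup.closure_induction with
  | mem a h =>
    obtain ⟨_, ⟨b, -, _, ⟨s, hs, rfl⟩, rfl⟩, c, -, rfl⟩ := h
    change PathAlgebra.leftDeriv (arr α i) (b * theta K A V s * c) ∈ _
    rw [mul_assoc, PathAlgebra.leftDeriv_mul, ← theta_one_mul_theta s, mul_assoc,
      (leftDeriv_theta_one_mul hi _).2, smul_zero, add_zero, ← mul_assoc (theta K A V 1),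
      theta_one_mul_theta, ← mul_assoc]
    exact TwoSidedIdeal.mul_mem_right _ _ _ (TwoSidedIdeal.mul_mem_left _ _ _
      (TwoSidedIdeal.subset_span ⟨s, hs, rfl⟩))
  | zero => rw [map_zero]; exact TwoSidedIdeal.zero_mem _
  | add a b ha' hb' ha hb =>
    rw [map_add]
    rw [← TwoSidedIdeal.mem_span_iff_mem_addSubgroup_closure] at ha' hb'
    exact TwoSidedIdeal.add_mem _ (ha ha') (hb hb')
  | neg a ha' ha =>
    rw [← TwoSidedIdeal.mem_span_iff_mem_addSubgroup_closure] at ha'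
    rw [map_neg]
    exact TwoSidedIdeal.neg_mem _ (ha ha')

/-- Here T = α_{k+1}⋯α_A, built by induction on its length `d`. Its arrows are cancelled one at a
time by derivatives; `1 ≤ k` keeps the excluded arrow α₁ out of T. -/
theorem exists_initialPath_mul_eq (hA : 1 ≤ A) (α : Quiver.Total V) {k : ℕ} (hk : 1 ≤ k) (d : ℕ)
    (h : k + d = A) : ∃ T : PathAlgebra K (Stretched A V),
      PathAlgebra.ofPath (initialPath α k (by lia)) * T = thetaArrow A α ∧
      PathAlgebra.vertex (pt α k) * T = T ∧
      ∀ (S : Set (PathAlgebra K V)) (z : PathAlgebra K (Stretched A V)), T * z ∈ ideal A S →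
        PathAlgebra.vertex (old α.right) * z ∈ ideal A S := by
  classical
  induction d generalizing k with
  | zero =>
    obtain rfl : k = A := by lia
    refine ⟨PathAlgebra.vertex (pt α k), ?_, vertex_mul_self _, fun S z hz => ?_⟩
    · rw [thetaArrow_eq hA, PathAlgebra.ofPath_mul_vertex]
    · rwa [pt_last hA] at hz
  | succ d ih =>
    obtain ⟨T, h1, h2, h3⟩ := ih (k := k + 1) (by lia) (by lia)
    refine ⟨PathAlgebra.arrow (arr α ⟨k, by lia⟩) * T, ?_, ?_, fun S z hz => h3 S z ?_⟩
    · rw [← mul_assoc, ← h1, initialPath, PathAlgebra.ofPath_cons]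
      rfl
    · rw [← mul_assoc]
      exact congrArg (· * T) (PathAlgebra.vertex_mul_arrow (arr α ⟨k, by lia⟩))
    · have := leftDeriv_mem_ideal (α := α) (i := ⟨k, by lia⟩) (by simp; lia) hz
      rw [mul_assoc, PathAlgebra.leftDeriv_arrow_mul, if_pos rfl] at this
      rw [← h2, mul_assoc]
      exact this

/-- The element `α₂ ⋯ α_A` can be cancelled on the left modulo the stretched ideal. -/
theorem exists_arrow_mul_eq (hA : 1 ≤ A) (α : Quiver.Total V) :
    ∃ T : PathAlgebra K (Stretched A V),
      PathAlgebra.arrow (arr α ⟨0, hA⟩) * T = theta K A V (PathAlgebra.arrow α) ∧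
      PathAlgebra.vertex (pt α 1) * T = T ∧
      ∀ (S : Set (PathAlgebra K V)) (z : PathAlgebra K (Stretched A V)), T * z ∈ ideal A S →
        PathAlgebra.vertex (old α.right) * z ∈ ideal A S := by
  obtain ⟨T, h1, h2, h3⟩ := exists_initialPath_mul_eq (K := K) hA α le_rfl (A - 1) (by lia)
  exact ⟨T, (theta_arrow (K := K) α).symm ▸ h1, h2, h3⟩

theorem constCoeff_theta (hA : 1 ≤ A) {a : PathAlgebra K V}
    (ha : ∀ b, PathAlgebra.constCoeff b a = 0) (x : Stretched A V) :
    PathAlgebra.constCoeff x (theta K A V a) = 0 := by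
  rw [PathAlgebra.eq_sum_constCoeff_add_sum_leftDeriv a]
  simp only [ha, zero_smul, Finset.sum_const_zero, zero_add, map_sum, map_mul,
    PathAlgebra.constCoeff_mul]
  refine Finset.sum_eq_zero fun α _ => ?_
  rw [theta_arrow, thetaArrow_eq hA, PathAlgebra.constCoeff_ofPath, if_neg, zero_mul]
  obtain ⟨j, rfl⟩ := Nat.exists_eq_add_of_le' hA
  simp [initialPath]

end Stretched

namespace PathAlgebra

variable {K : Type w} {V : Type u} [Field K] [Quiver.{v} V] [Fintype V]

/-! ### Congruence modulo the ideal -/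

section Quotient

variable (I : TwoSidedIdeal (PathAlgebra K V))

theorem mk_eq_mk_iff {x y : PathAlgebra K V} :
    I.ringCon.mk' x = I.ringCon.mk' y ↔ x - y ∈ I := by
  rw [← TwoSidedIdeal.rel_iff]
  exact RingCon.eq _

theorem mk_eq_zero_iff {x : PathAlgebra K V} : I.ringCon.mk' x = 0 ↔ x ∈ I := by
  rw [← map_zero I.ringCon.mk', mk_eq_mk_iff, sub_zero]

theorem mk_surjective : Function.Surjective I.ringCon.mk' := RingCon.mk'_surjective _

/-! ### The Jacobson radical -/

/-- Every product xb has no constant coefficients either, hence is nilpotent modulo `I`, and 1 - xb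
is a unit. A maximal right ideal that misses x would contain such a unit. -/
theorem mk_mem_jacobson [Fintype (Quiver.Total V)] {N : ℕ}
    (hN : ∀ x ∈ arrowIdealPow K V N, x ∈ I) {x : PathAlgebra K V}
    (hx : ∀ a, constCoeff a x = 0) :
    I.ringCon.mk' x ∈ Module.jacobson (Quot I)ᵐᵒᵖ (Quot I) := by
  rw [Module.jacobson, Submodule.mem_sInf]
  intro M hM
  by_contra hxM
  have h1 : M ⊔ Submodule.span _ {I.ringCon.mk' x} = ⊤ := by
    refine hM.2 _ (left_lt_sup.2 fun h => hxM (h (Submodule.mem_span_singleton_self _)))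
  have h2 : (1 : Quot I) ∈ M ⊔ Submodule.span _ {I.ringCon.mk' x} := h1 ▸ Submodule.mem_top
  obtain ⟨m, hm, y, hy, e⟩ := Submodule.mem_sup.1 h2
  obtain ⟨c, rfl⟩ := Submodule.mem_span_singleton.1 hy
  obtain ⟨b, hb⟩ := mk_surjective I c.unop
  have hc : c • I.ringCon.mk' x = I.ringCon.mk' (x * b) := by
    rw [map_mul, hb]; rfl
  have hnil : IsNilpotent (I.ringCon.mk' (x * b)) := by
    refine ⟨N, ?_⟩
    rw [← map_pow, mk_eq_zero_iff]
    refine hN _ (pow_mem_arrowIdealPow (mem_arrowIdealPow_one_iff.2 fun a => ?_) N)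
    rw [constCoeff_mul, hx, zero_mul]
  obtain ⟨t, ht⟩ := hnil.isUnit_one_sub
  have hm' : m = t := by rw [ht, ← hc, ← e, add_sub_cancel_right]
  apply hM.1
  rw [eq_top_iff]
  rintro z -
  have := M.smul_mem (op (↑t⁻¹ * z)) hm
  rw [hm'] at this
  simpa using this

/-- The classes with vanishing constant coefficient at `a` form a right ideal of codimension one,
well defined by `hI`, hence a maximal one. -/
theorem constCoeff_eq_zero_of_mk_mem_jacobson (hI : ∀ x ∈ I, ∀ a, constCoeff a x = 0)
    {x : PathAlgebra K V} (hx : I.ringCon.mk' x ∈ Module.jacobson (Quot I)ᵐᵒᵖ (Quot I)) (a : V) :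
    constCoeff a x = 0 := by
  let M : Submodule (Quot I)ᵐᵒᵖ (Quot I) :=
    { carrier := {z | ∃ y, I.ringCon.mk' y = z ∧ constCoeff a y = 0}
      zero_mem' := ⟨0, map_zero _, map_zero _⟩
      add_mem' := by
        rintro _ _ ⟨y, rfl, hy⟩ ⟨z, rfl, hz⟩
        exact ⟨y + z, map_add _ _ _, by rw [map_add, hy, hz, add_zero]⟩
      smul_mem' := by
        rintro c _ ⟨y, rfl, hy⟩
        obtain ⟨b, hb⟩ := mk_surjective I c.unop
        refine ⟨y * b, ?_, by rw [constCoeff_mul, hy, zero_mul]⟩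
        rw [map_mul, hb]
        rfl }
  have hM : ∀ y, I.ringCon.mk' y ∈ M → constCoeff a y = 0 := by
    rintro y ⟨z, hz, h0⟩
    rw [mk_eq_mk_iff] at hz
    have := hI _ hz a
    rwa [map_sub, h0, zero_sub, neg_eq_zero] at this
  have hco : IsCoatom M := by
    refine ⟨fun h => ?_, fun L hL => ?_⟩
    · have := hM (vertex a) (h ▸ Submodule.mem_top)
      rw [constCoeff_vertex] at this
      exact one_ne_zero this
    · obtain ⟨z, hzL, hzM⟩ := SetLike.exists_of_lt hL
      obtain ⟨y, rfl⟩ := mk_surjective I z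
      have hy : constCoeff a y ≠ 0 := fun h => hzM ⟨y, rfl, h⟩
      rw [eq_top_iff]
      rintro z -
      obtain ⟨t, rfl⟩ := mk_surjective I z
      -- The multiple of `y` is scaled to have the same constant coefficient at `a` as `t`, so that
      -- the difference lies in `M`.
      have h1 : I.ringCon.mk' (y * ((constCoeff a y)⁻¹ • t)) ∈ L := by
        rw [map_mul]
        exact L.smul_mem (op _) hzL
      have h2 : I.ringCon.mk' (t - y * ((constCoeff a y)⁻¹ • t)) ∈ L := by
        refine hL.le ⟨_, rfl, ?_⟩
        rw [map_sub, constCoeff_mul, map_smul, smul_eq_mul, mul_inv_cancel_left₀ hy, sub_self]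
      have := L.add_mem h1 h2
      rwa [← map_add, add_sub_cancel] at this
  exact hM x (Submodule.mem_sInf.1 hx M hco)

/-! ### The modules `⨁ 𝔱(x)Λ` -/

/-- The terminus is idempotent, so 𝔱(x)Λ is a direct summand of Λ. The free right module appears as
`(Quot I)ᵐᵒᵖ`, a left module over itself. -/
theorem projective_terminusModule {x : PathAlgebra K V} (hx : IsUniform x) :
    Module.Projective (Quot I)ᵐᵒᵖ (terminusModule I x) := by
  have key : ∀ z ∈ terminusModule I x, I.ringCon.mk' (terminus x) * z = z := by
    intro z hz
    obtain ⟨c, rfl⟩ := Submodule.mem_span_singleton.1 hz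
    change _ * (_ * c.unop) = _ * c.unop
    rw [← mul_assoc, ← map_mul, hx.terminus_mul_self]
  let i : terminusModule I x →ₗ[(Quot I)ᵐᵒᵖ] (Quot I)ᵐᵒᵖ :=
    { toFun := fun z => op (z : Quot I)
      map_add' := fun _ _ => rfl
      map_smul' := fun _ _ => rfl }
  let s : (Quot I)ᵐᵒᵖ →ₗ[(Quot I)ᵐᵒᵖ] terminusModule I x :=
    LinearMap.toSpanSingleton _ _ ⟨_, Submodule.mem_span_singleton_self _⟩
  refine Module.Projective.of_split i s (LinearMap.ext fun z => Subtype.ext ?_)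
  exact key z z.2

theorem projective_proj {G : Finset (PathAlgebra K V)} (hG : ∀ x ∈ G, IsUniform x) :
    Module.Projective (Quot I)ᵐᵒᵖ (Proj I G) := by
  classical
  have : ∀ x : G, Module.Projective (Quot I)ᵐᵒᵖ (terminusModule I (x : PathAlgebra K V)) :=
    fun x => projective_terminusModule I (hG x x.2)
  exact Module.Projective.of_equiv' (M := Π₀ x : G, terminusModule I (x : PathAlgebra K V))
    DFinsupp.linearEquivFunOnFintype

/-- The element of `⨁_{x ∈ G} 𝔱(x)Λ` with entries `𝔱(x) p(x)`. -/
def mkProj (G : Finset (PathAlgebra K V)) (p : PathAlgebra K V → PathAlgebra K V) : Proj I G :=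
  fun x => ⟨I.ringCon.mk' (terminus (x : PathAlgebra K V)) * I.ringCon.mk' (p x),
    mk_terminus_mul_mem I _ _⟩

variable {I} {G G' G'' : Finset (PathAlgebra K V)}

theorem coe_mkProj (p : PathAlgebra K V → PathAlgebra K V) (x : G) :
    (mkProj I G p x : Quot I) = I.ringCon.mk' (terminus (x : PathAlgebra K V) * p x) :=
  (map_mul _ _ _).symm

theorem exists_mkProj_eq (hG : ∀ x ∈ G, IsUniform x) (P : Proj I G) :
    ∃ p, (∀ x ∈ G, terminus x * p x = p x) ∧ mkProj I G p = P := by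
  classical
  have h : ∀ x : G, ∃ y, terminus (x : PathAlgebra K V) * y = y ∧ I.ringCon.mk' y = P x := by
    intro x
    obtain ⟨c, hc⟩ := Submodule.mem_span_singleton.1 (P x).2
    obtain ⟨b, hb⟩ := mk_surjective I c.unop
    refine ⟨terminus (x : PathAlgebra K V) * b, ?_, ?_⟩
    · rw [← mul_assoc, (hG x x.2).terminus_mul_self]
    · rw [← hc, map_mul, hb]
      rfl
  choose y h1 h2 using h
  refine ⟨fun x => if hx : x ∈ G then y ⟨x, hx⟩ else 0, fun x hx => ?_, ?_⟩
  · simp only [dif_pos hx]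
    exact h1 ⟨x, hx⟩
  · funext x
    apply Subtype.ext
    rw [coe_mkProj, dif_pos x.2, h1, h2]

theorem mkProj_eq_iff {p q : PathAlgebra K V → PathAlgebra K V} :
    mkProj I G p = mkProj I G q ↔ ∀ x ∈ G, terminus x * (p x - q x) ∈ I := by
  rw [funext_iff]
  simp only [Subtype.ext_iff, coe_mkProj, mk_eq_mk_iff, ← mul_sub, Subtype.forall]

theorem mkProj_zero : mkProj I G (fun _ => 0) = 0 := by
  funext x
  apply Subtype.ext
  rw [coe_mkProj, mul_zero, map_zero]
  rfl

theorem mkProj_eq_zero_iff {p : PathAlgebra K V → PathAlgebra K V} :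
    mkProj I G p = 0 ↔ ∀ x ∈ G, terminus x * p x ∈ I := by
  rw [← mkProj_zero, mkProj_eq_iff]
  simp only [sub_zero]

theorem differential_mkProj {r : PathAlgebra K V → PathAlgebra K V → PathAlgebra K V}
    {p : PathAlgebra K V → PathAlgebra K V} (hp : ∀ x ∈ G', terminus x * p x = p x) :
    differential I G' G r (mkProj I G' p) = mkProj I G fun y => ∑ x ∈ G', r x y * p x := by
  funext y
  apply Subtype.ext
  rw [coe_mkProj, ← Finset.sum_coe_sort, Finset.mul_sum, map_sum]
  change (∑ x : G', I.ringCon.mk' (terminus (y : PathAlgebra K V)) *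
    (I.ringCon.mk' (r x y) * (mkProj I G' p x : Quot I))) = _
  refine Finset.sum_congr rfl fun x _ => ?_
  rw [coe_mkProj, hp x x.2, ← map_mul, ← map_mul]

theorem augmentation_mkProj {p : PathAlgebra K V → PathAlgebra K V}
    (hp : ∀ x ∈ G, terminus x * p x = p x) :
    augmentation I G (mkProj I G p) = Submodule.Quotient.mk (I.ringCon.mk' (∑ x ∈ G, p x)) := by
  rw [augmentation, LinearMap.comp_apply, Submodule.mkQ_apply, map_sum,
    ← Finset.sum_coe_sort G fun x => I.ringCon.mk' (p x), LinearMap.sum_apply]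
  refine congrArg Submodule.Quotient.mk (Finset.sum_congr rfl fun x _ => ?_)
  change (mkProj I G p x : Quot I) = _
  rw [coe_mkProj, hp x x.2]

/-- Exactness restated for representatives in K𝒬, so that the later arguments take place in path
algebras modulo an ideal. -/
theorem exact_differential_iff {r : PathAlgebra K V → PathAlgebra K V → PathAlgebra K V}
    {r' : PathAlgebra K V → PathAlgebra K V → PathAlgebra K V} (hG'' : ∀ x ∈ G'', IsUniform x)
    (hG' : ∀ x ∈ G', IsUniform x) :
    Function.Exact (differential I G'' G' r') (differential I G' G r) ↔
      ∀ p : PathAlgebra K V → PathAlgebra K V, (∀ x ∈ G', terminus x * p x = p x) →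
        ((∀ y ∈ G, terminus y * ∑ x ∈ G', r x y * p x ∈ I) ↔
          ∃ c : PathAlgebra K V → PathAlgebra K V, (∀ w ∈ G'', terminus w * c w = c w) ∧
            ∀ x ∈ G', terminus x * (p x - ∑ w ∈ G'', r' w x * c w) ∈ I) := by
  have key : ∀ p : PathAlgebra K V → PathAlgebra K V,
      mkProj I G' p ∈ Set.range (differential I G'' G' r') ↔
        ∃ c : PathAlgebra K V → PathAlgebra K V, (∀ w ∈ G'', terminus w * c w = c w) ∧
            ∀ x ∈ G', terminus x * (p x - ∑ w ∈ G'', r' w x * c w) ∈ I := by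
    intro p
    constructor
    · rintro ⟨C, hC⟩
      obtain ⟨c, hc, rfl⟩ := exists_mkProj_eq hG'' C
      rw [differential_mkProj hc] at hC
      exact ⟨c, hc, mkProj_eq_iff.1 hC.symm⟩
    · rintro ⟨c, hc, h⟩
      refine ⟨mkProj I G'' c, ?_⟩
      rw [differential_mkProj hc]
      exact (mkProj_eq_iff.2 h).symm
  constructor
  · intro h p hp
    rw [← key, ← h, differential_mkProj hp, mkProj_eq_zero_iff]
  · intro h P
    obtain ⟨p, hp, rfl⟩ := exists_mkProj_eq hG' P
    rw [key, ← h p hp, differential_mkProj hp, mkProj_eq_zero_iff]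

/-! ### Minimality -/

/-- Module maps carry radicals into radicals. Projecting to a summand detects one entry; conversely,
an element of ⨁𝔱(y)Λ is a sum of images of its entries under maps from Λ. -/
theorem range_differential_le_jacobson_iff [Fintype (Quiver.Total V)] {N : ℕ}
    (hN : ∀ x ∈ arrowIdealPow K V N, x ∈ I) (hI : ∀ x ∈ I, ∀ a, constCoeff a x = 0)
    {r : PathAlgebra K V → PathAlgebra K V → PathAlgebra K V}
    (hG' : ∀ x ∈ G', IsUniform x) (hr : ∀ x ∈ G', ∀ y ∈ G, terminus y * r x y = r x y)
    (hr' : ∀ x ∈ G', ∀ y ∈ G, r x y * terminus x = r x y) :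
    LinearMap.range (differential I G' G r) ≤ Module.jacobson (Quot I)ᵐᵒᵖ (Proj I G) ↔
      ∀ x ∈ G', ∀ y ∈ G, ∀ a, constCoeff a (r x y) = 0 := by
  classical
  constructor
  · intro h x hx y hy a
    -- The generator of the summand 𝔱(x)Λ, whose image has the entries `r x y`.
    let p : PathAlgebra K V → PathAlgebra K V := fun z => if z = x then terminus x else 0
    have hp : ∀ z ∈ G', terminus z * p z = p z := by
      intro z hz
      by_cases e : z = x
      · subst e
        simp only [p, if_pos, (hG' z hz).terminus_mul_self]
      · simp only [p, if_neg e, mul_zero]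
    have h1 := h ⟨mkProj I G' p, rfl⟩
    rw [differential_mkProj hp] at h1
    let f : Proj I G →ₗ[(Quot I)ᵐᵒᵖ] Quot I :=
      (Submodule.subtype _).comp (LinearMap.proj ⟨y, hy⟩)
    have h2 := Module.map_jacobson_le f (Submodule.mem_map_of_mem h1)
    have h3 := coe_mkProj (I := I) (fun y => ∑ x ∈ G', r x y * p x) ⟨y, hy⟩
    refine constCoeff_eq_zero_of_mk_mem_jacobson I hI ?_ a
    convert h2 using 1
    refine Eq.trans ?_ h3.symm
    rw [Finset.sum_eq_single x]
    · simp only [p, if_pos, hr' x hx y hy, hr x hx y hy]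
    · intro z _ hz
      simp only [p, if_neg hz, mul_zero]
    · exact fun h => (h hx).elim
  · rintro h _ ⟨P, rfl⟩
    obtain ⟨p, hp, rfl⟩ := exists_mkProj_eq hG' P
    rw [differential_mkProj hp]
    have h1 : ∀ y : G, ∃ f : Quot I →ₗ[(Quot I)ᵐᵒᵖ] Proj I G, ∀ z, f (I.ringCon.mk' z) =
        mkProj I G fun t => if t = y then z else 0 := by
      intro y
      let s : Quot I →ₗ[(Quot I)ᵐᵒᵖ] terminusModule I (y : PathAlgebra K V) :=
        { toFun := fun z => ⟨_, mk_terminus_mul_mem I y z⟩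
          map_add' := fun _ _ => Subtype.ext (mul_add _ _ _)
          map_smul' := fun _ _ => Subtype.ext (mul_assoc _ _ _).symm }
      refine ⟨(LinearMap.single _ _ y).comp s, fun z => ?_⟩
      funext t
      apply Subtype.ext
      rw [coe_mkProj]
      by_cases e : t = y
      · subst e
        simp [s]
      · simp [s, Subtype.ext_iff.not.1 e, e]
    choose f hf using h1
    have h2 : mkProj I G (fun y => ∑ x ∈ G', r x y * p x) =
        ∑ y : G, f y (I.ringCon.mk' (∑ x ∈ G', r x y * p x)) := by
      funext t
      apply Subtype.ext
      rw [coe_mkProj, Finset.sum_apply, AddSubmonoidClass.coe_finsetSum, Finset.sum_eq_single t]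
      · rw [hf, coe_mkProj, if_pos rfl]
      · intro y _ hy
        rw [hf, coe_mkProj, if_neg fun e => hy (Subtype.ext e.symm), mul_zero, map_zero]
      · simp
    rw [h2]
    refine Submodule.sum_mem _ fun y _ => Module.map_jacobson_le (f y)
      (Submodule.mem_map_of_mem (mk_mem_jacobson I hN fun a => ?_))
    rw [map_sum]
    refine Finset.sum_eq_zero fun x hx => ?_
    rw [constCoeff_mul, h x hx y y.2, zero_mul]

end Quotient

end PathAlgebra

namespace PathAlgebra

variable {K : Type w} {V : Type u} [Field K] [Quiver.{v} V] [Fintype V]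
variable {I : TwoSidedIdeal (PathAlgebra K V)} {G G' G'' : Finset (PathAlgebra K V)}

/-! ### Expansions -/

/-- Since x = x𝔱(x), multiplying all coefficients by 𝔱(x) on the right gives another expansion of x.
-/
theorem IsExpansion.mul_terminus (hG : RightIndependent G) {x : PathAlgebra K V}
    (hx : IsUniform x) {c : PathAlgebra K V → PathAlgebra K V} (hc : IsExpansion G x c) :
    ∀ y ∈ G, c y * terminus x = c y := by
  refine hG.unique (x := x) ⟨fun y hy => ?_, ?_⟩ hc
  · rw [← mul_assoc, hc.1 y hy]
  · simp only [← mul_assoc]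
    rw [← Finset.sum_mul, ← hc.2, hx.mul_terminus]

theorem IsExpansion.comp {x : PathAlgebra K V} {c : PathAlgebra K V → PathAlgebra K V}
    {r : PathAlgebra K V → PathAlgebra K V → PathAlgebra K V} (hc : IsExpansion G' x c)
    (hr : ∀ y ∈ G', IsExpansion G y (r y)) :
    IsExpansion G x fun z => ∑ y ∈ G', r y z * c y := by
  refine ⟨fun z hz => ?_, ?_⟩
  · rw [Finset.mul_sum]
    refine Finset.sum_congr rfl fun y hy => ?_
    rw [← mul_assoc, (hr y hy).1 z hz]
  · simp only [Finset.mul_sum]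
    rw [Finset.sum_comm]
    nth_rewrite 1 [hc.2]
    refine Finset.sum_congr rfl fun y hy => ?_
    nth_rewrite 1 [(hr y hy).2]
    rw [Finset.sum_mul]
    simp only [mul_assoc]

theorem vertex_mul_sum (hG : (G : Set (PathAlgebra K V)) = Set.range vertex)
    {p : PathAlgebra K V → PathAlgebra K V} (hp : ∀ y ∈ G, terminus y * p y = p y)
    {y : PathAlgebra K V} (hy : y ∈ G) : y * ∑ z ∈ G, p z = p y := by
  have hv : ∀ y ∈ G, ∃ a, vertex a = y := fun y hy => by
    have : y ∈ (G : Set (PathAlgebra K V)) := hy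
    rwa [hG] at this
  obtain ⟨a, rfl⟩ := hv y hy
  rw [Finset.mul_sum, Finset.sum_eq_single (vertex a)]
  · rw [← hp _ hy, terminus_vertex, ← mul_assoc, Stretched.vertex_mul_self]
  · intro z hz hne
    rw [← hp z hz]
    obtain ⟨b, rfl⟩ := hv z hz
    rw [terminus_vertex, ← mul_assoc, Stretched.vertex_mul_of_ne, zero_mul]
    rintro rfl
    exact hne rfl
  · exact fun h => (h hy).elim

theorem sum_vertices (hG : (G : Set (PathAlgebra K V)) = Set.range vertex) : ∑ y ∈ G, y = 1 := by
  classical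
  have : G = Finset.univ.image vertex := by
    apply Finset.coe_injective
    rw [hG, Finset.coe_image, Finset.coe_univ, Set.image_univ]
  rw [this, Finset.sum_image vertex_injective.injOn, one_def]

theorem isExpansion_vertices (hG : (G : Set (PathAlgebra K V)) = Set.range vertex)
    (x : PathAlgebra K V) : IsExpansion G x fun y => y * x := by
  have hv : ∀ y ∈ G, ∃ a, vertex a = y := fun y hy => by
    have : y ∈ (G : Set (PathAlgebra K V)) := hy
    rwa [hG] at this
  have h : ∀ y ∈ G, terminus y = y ∧ y * y = y := by
    intro y hy
    obtain ⟨a, rfl⟩ := hv y hy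
    exact ⟨terminus_vertex a, Stretched.vertex_mul_self a⟩
  refine ⟨fun y hy => ?_, ?_⟩
  · rw [(h y hy).1, ← mul_assoc, (h y hy).2]
  · rw [Finset.sum_congr rfl fun y hy => show y * (y * x) = y * x by
      rw [← mul_assoc, (h y hy).2], ← Finset.sum_mul, sum_vertices hG, one_mul]

open scoped Classical in
/-- The coefficients of the expansion of an element of the arrow ideal with respect to the arrows. -/
def arrowCoeff (x y : PathAlgebra K V) : PathAlgebra K V :=
  if h : ∃ β, arrow β = y then leftDeriv h.choose x else 0

theorem arrowCoeff_arrow (x : PathAlgebra K V) (β : Quiver.Total V) :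
    arrowCoeff x (arrow β) = leftDeriv β x := by
  have h : ∃ γ, arrow γ = (arrow β : PathAlgebra K V) := ⟨β, rfl⟩
  rw [arrowCoeff, dif_pos h, arrow_injective h.choose_spec]

theorem isExpansion_arrows [Fintype (Quiver.Total V)]
    (hG : (G : Set (PathAlgebra K V)) = Set.range arrow) {x : PathAlgebra K V}
    (hx : ∀ a, constCoeff a x = 0) : IsExpansion G x (arrowCoeff x) := by
  classical
  have : G = Finset.univ.image arrow := by
    apply Finset.coe_injective
    rw [hG, Finset.coe_image, Finset.coe_univ, Set.image_univ]
  refine ⟨fun y hy => ?_, ?_⟩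
  · rw [← Finset.mem_coe, hG] at hy
    obtain ⟨β, rfl⟩ := hy
    rw [terminus_arrow, arrowCoeff_arrow, vertex_right_mul_leftDeriv]
  · rw [this, Finset.sum_image arrow_injective.injOn]
    simp only [arrowCoeff_arrow]
    nth_rewrite 1 [eq_sum_constCoeff_add_sum_leftDeriv x]
    simp only [hx, zero_smul, Finset.sum_const_zero, zero_add]

/-! ### Exactness in low degrees -/

/-- By uniqueness the coefficients of an arrow x are y x at the vertices y. Both kernel and image
then describe the p whose sum has no constant coefficients, that is, lies in the arrow ideal. -/
theorem exact_augmentation [Fintype (Quiver.Total V)] {N : ℕ}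
    (hN : ∀ x ∈ arrowIdealPow K V N, x ∈ I) (hI : ∀ x ∈ I, ∀ a, constCoeff a x = 0)
    {r : PathAlgebra K V → PathAlgebra K V → PathAlgebra K V}
    (hG : (G : Set (PathAlgebra K V)) = Set.range vertex)
    (hG' : (G' : Set (PathAlgebra K V)) = Set.range arrow)
    (hu : ∀ y ∈ G, IsUniform y) (hu' : ∀ x ∈ G', IsUniform x)
    (hr : ∀ x ∈ G', IsExpansion G x (r x)) :
    Function.Exact (differential I G' G r) (augmentation I G) := by
  have hrv : ∀ c : PathAlgebra K V → PathAlgebra K V, ∀ y ∈ G,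
      ∑ x ∈ G', r x y * c x = y * ∑ x ∈ G', x * c x := by
    intro c y hy
    rw [Finset.mul_sum]
    refine Finset.sum_congr rfl fun x hx => ?_
    rw [← mul_assoc, (rightIndependent_vertices hG).unique (hr x hx) (isExpansion_vertices hG x)
      y hy]
  intro P
  obtain ⟨p, hp, rfl⟩ := exists_mkProj_eq hu P
  rw [augmentation_mkProj hp, Submodule.Quotient.mk_eq_zero]
  constructor
  · intro h
    have hz := fun a => constCoeff_eq_zero_of_mk_mem_jacobson I hI h a
    have he := isExpansion_arrows hG' hz
    refine ⟨mkProj I G' (arrowCoeff (∑ x ∈ G, p x)), ?_⟩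
    rw [differential_mkProj he.1]
    refine mkProj_eq_iff.2 fun y hy => ?_
    rw [hrv _ y hy, ← he.2, vertex_mul_sum hG hp hy, sub_self, mul_zero]
    exact I.zero_mem
  · rintro ⟨C, hC⟩
    obtain ⟨c, hc, rfl⟩ := exists_mkProj_eq hu' C
    rw [differential_mkProj hc] at hC
    have h := mkProj_eq_iff.1 hC
    refine mk_mem_jacobson I hN fun a => ?_
    have h1 : ∑ y ∈ G, terminus y * (∑ x ∈ G', r x y * c x - p y) ∈ I := sum_mem h
    have h2 : ∑ y ∈ G, terminus y * (∑ x ∈ G', r x y * c x - p y) =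
        ∑ x ∈ G', x * c x - ∑ y ∈ G, p y := by
      have hs := sum_vertices hG
      rw [← one_mul (∑ x ∈ G', x * c x), ← hs, Finset.sum_mul, ← Finset.sum_sub_distrib]
      refine Finset.sum_congr rfl fun y hy => ?_
      rw [mul_sub, hp y hy, hrv c y hy, ← mul_assoc]
      have hy' := hy
      rw [← Finset.mem_coe, hG] at hy'
      obtain ⟨b, rfl⟩ := hy'
      rw [terminus_vertex, Stretched.vertex_mul_self]
    rw [h2] at h1
    have h3 := hI _ h1 a
    rw [map_sub, map_sum, Finset.sum_eq_zero, zero_sub, neg_eq_zero] at h3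
    · exact h3
    · intro x hx
      rw [← Finset.mem_coe, hG'] at hx
      obtain ⟨β, rfl⟩ := hx
      rw [constCoeff_mul, constCoeff_arrow, zero_mul]

/-- Every element of the ideal generated by `G` is congruent modulo `JI` to an element of the right
ideal generated by `G`. -/
theorem exists_leftDeriv_sub_mem (hG : ∀ x ∈ G, IsUniform x)
    (hG0 : ∀ x ∈ G, ∀ a, constCoeff a x = 0) {s : PathAlgebra K V}
    (hs : s ∈ TwoSidedIdeal.span (G : Set (PathAlgebra K V))) :
    ∃ c : PathAlgebra K V → PathAlgebra K V, (∀ w ∈ G, terminus w * c w = c w) ∧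
      ∀ β, leftDeriv β s - ∑ w ∈ G, leftDeriv β w * c w ∈
        TwoSidedIdeal.span (G : Set (PathAlgebra K V)) := by
  classical
  rw [TwoSidedIdeal.mem_span_iff_mem_addSubgroup_closure] at hs
  induction hs using AddSubgroup.closure_induction with
  | mem s h =>
    obtain ⟨_, ⟨b, -, x, hx, rfl⟩, t, -, rfl⟩ := h
    have hx' : x ∈ G := hx
    obtain ⟨a, ha⟩ := (hG x hx').2.1
    -- For a generator bxt only the constant coefficient of b at the start `a` of x matters; the
    -- rest of b contributes to JI.
    refine ⟨fun w => if w = x then terminus x * (constCoeff a b • t) else 0, fun w hw => ?_,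
      fun β => ?_⟩
    · by_cases e : w = x
      · subst e
        simp only [if_pos, ← mul_assoc, (hG w hw).terminus_mul_self]
      · simp only [if_neg e, mul_zero]
    · rw [Finset.sum_eq_single x]
      · change leftDeriv β (b * x * t) - _ ∈ _
        have h1 : leftDeriv β x * terminus x = leftDeriv β x := by
          obtain ⟨v, hv, _⟩ := (hG x hx').exists_terminus_eq
          have := leftDeriv_mul β x (terminus x)
          rw [(hG x hx').mul_terminus, hv, leftDeriv_vertex, smul_zero, add_zero] at this
          rw [hv, ← this]
        have h2 : leftDeriv β x = constCoeff (K := K) β.left (vertex a) • leftDeriv β x := by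
          nth_rewrite 1 [← ha]
          rw [leftDeriv_mul, leftDeriv_vertex, zero_mul, zero_add]
        have h3 : constCoeff β.left b • leftDeriv β x = constCoeff a b • leftDeriv β x := by
          by_cases e : a = β.left
          · rw [e]
          · rw [vertex, constCoeff_ofPath, if_neg fun h => e h.2, zero_smul] at h2
            rw [h2, smul_zero, smul_zero]
        have h4 : leftDeriv β (b * x * t) = leftDeriv β b * x * t +
            leftDeriv β x * (terminus x * (constCoeff a b • t)) := by
          rw [mul_assoc, leftDeriv_mul, leftDeriv_mul, hG0 x hx', zero_smul, add_zero,
            ← mul_assoc (leftDeriv β x) (terminus x), h1, ← mul_assoc, mul_smul_comm,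
            ← smul_mul_assoc, h3, smul_mul_assoc]
        simp only [if_pos]
        rw [h4, add_sub_cancel_right]
        exact TwoSidedIdeal.mul_mem_right _ _ _ (TwoSidedIdeal.mul_mem_left _ _ _
          (TwoSidedIdeal.subset_span hx))
      · intro w _ hw
        simp only [if_neg hw, mul_zero]
      · exact fun h => (h hx').elim
  | zero =>
    refine ⟨fun _ => 0, fun _ _ => mul_zero _, fun β => ?_⟩
    simp
  | add s t _ _ hs ht =>
    obtain ⟨c, hc, hc'⟩ := hs
    obtain ⟨d, hd, hd'⟩ := ht
    refine ⟨fun w => c w + d w, fun w hw => by rw [mul_add, hc w hw, hd w hw], fun β => ?_⟩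
    have := TwoSidedIdeal.add_mem _ (hc' β) (hd' β)
    simp only [map_add, mul_add, Finset.sum_add_distrib]
    convert this using 1
    abel
  | neg s _ hs =>
    obtain ⟨c, hc, hc'⟩ := hs
    refine ⟨fun w => -c w, fun w hw => by rw [mul_neg, hc w hw], fun β => ?_⟩
    have := TwoSidedIdeal.neg_mem _ (hc' β)
    simp only [map_neg, mul_neg, Finset.sum_neg_distrib]
    convert this using 1
    abel

/-- The kernel consists of the p with ∑ x p(x) in `I`. Such a sum agrees modulo JI with a right
combination of the generators, and derivatives compare the coefficients arrow by arrow. -/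
theorem exact_differential_arrows
    {r r' : PathAlgebra K V → PathAlgebra K V → PathAlgebra K V}
    (hG : (G : Set (PathAlgebra K V)) = Set.range vertex)
    (hG' : (G' : Set (PathAlgebra K V)) = Set.range arrow)
    (hG'' : TwoSidedIdeal.span (G'' : Set (PathAlgebra K V)) = I)
    (hG0 : ∀ x ∈ G'', ∀ a, constCoeff a x = 0)
    (hu' : ∀ x ∈ G', IsUniform x) (hu'' : ∀ w ∈ G'', IsUniform w)
    (hr : ∀ x ∈ G', IsExpansion G x (r x)) (hr' : ∀ w ∈ G'', IsExpansion G' w (r' w)) :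
    Function.Exact (differential I G'' G' r') (differential I G' G r) := by
  rw [exact_differential_iff hu'' hu']
  intro p hp
  have hs : (∀ y ∈ G, terminus y * ∑ x ∈ G', r x y * p x ∈ I) ↔ ∑ x ∈ G', x * p x ∈ I := by
    have e : ∀ y ∈ G, terminus y * ∑ x ∈ G', r x y * p x = y * ∑ x ∈ G', x * p x := by
      intro y hy
      rw [Finset.mul_sum, Finset.mul_sum]
      refine Finset.sum_congr rfl fun x hx => ?_
      rw [← mul_assoc, (hr x hx).1 y hy, ← mul_assoc,
        (rightIndependent_vertices hG).unique (hr x hx) (isExpansion_vertices hG x) y hy]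
    constructor
    · intro h
      rw [← one_mul (∑ x ∈ G', x * p x), ← sum_vertices hG, Finset.sum_mul]
      exact sum_mem fun y hy => e y hy ▸ h y hy
    · intro h y hy
      rw [e y hy]
      exact I.mul_mem_left _ _ h
  rw [hs]
  constructor
  · intro h
    subst hG''
    obtain ⟨c, hc, h'⟩ := exists_leftDeriv_sub_mem hu'' hG0 h
    refine ⟨c, hc, fun x hx => TwoSidedIdeal.mul_mem_left _ _ _ ?_⟩
    have hx' := hx
    rw [← Finset.mem_coe, hG'] at hx'
    obtain ⟨β, rfl⟩ := hx'
    convert h' β using 1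
    rw [leftDeriv_sum_arrows hG', ← terminus_arrow, hp _ hx]
    congr 1
    refine Finset.sum_congr rfl fun w hw => ?_
    have := leftDeriv_sum_arrows hG' (r' w) β
    rw [← (hr' w hw).2, ← terminus_arrow, (hr' w hw).1 _ hx] at this
    rw [this]
  · rintro ⟨c, hc, h⟩
    have h1 : ∑ x ∈ G', x * (terminus x * (p x - ∑ w ∈ G'', r' w x * c w)) ∈ I :=
      sum_mem fun x hx => I.mul_mem_left _ _ (h x hx)
    have h2 : ∑ x ∈ G', x * (terminus x * (p x - ∑ w ∈ G'', r' w x * c w)) =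
        ∑ x ∈ G', x * p x - ∑ w ∈ G'', w * c w := by
      have : ∑ w ∈ G'', w * c w = ∑ x ∈ G', x * ∑ w ∈ G'', r' w x * c w := by
        simp only [Finset.mul_sum]
        rw [Finset.sum_comm]
        refine Finset.sum_congr rfl fun w hw => ?_
        nth_rewrite 1 [(hr' w hw).2]
        rw [Finset.sum_mul]
        simp only [mul_assoc]
      rw [this, ← Finset.sum_sub_distrib]
      refine Finset.sum_congr rfl fun x hx => ?_
      rw [← mul_assoc, (hu' x hx).mul_terminus, mul_sub]
    rw [h2] at h1
    have h3 : ∑ w ∈ G'', w * c w ∈ I := by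
      refine sum_mem fun w hw => I.mul_mem_right _ _ ?_
      rw [← hG'']
      exact TwoSidedIdeal.subset_span hw
    simpa using I.add_mem h1 h3

/-- Reduces exactness to the inclusion of the kernel in the image. The composite of the
differentials vanishes because its coefficients expand `w` over `G`, hence by uniqueness equal the
coefficients `s` in the ideal. -/
theorem exact_differential_of {r r' : PathAlgebra K V → PathAlgebra K V → PathAlgebra K V}
    (hu' : ∀ x ∈ G', IsUniform x) (hu'' : ∀ w ∈ G'', IsUniform w)
    (hG : (G'.Nonempty) → RightIndependent G)
    (hr : ∀ x ∈ G', IsExpansion G x (r x)) (hr' : ∀ w ∈ G'', IsExpansion G' w (r' w))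
    (hI : ∀ w ∈ G'', ∃ s, IsExpansion G w s ∧ ∀ y ∈ G, s y ∈ I)
    (h : ∀ p : PathAlgebra K V → PathAlgebra K V, (∀ x ∈ G', terminus x * p x = p x) →
      (∀ y ∈ G, terminus y * ∑ x ∈ G', r x y * p x ∈ I) →
        ∃ c : PathAlgebra K V → PathAlgebra K V, (∀ w ∈ G'', terminus w * c w = c w) ∧
          ∀ x ∈ G', terminus x * (p x - ∑ w ∈ G'', r' w x * c w) ∈ I) :
    Function.Exact (differential I G'' G' r') (differential I G' G r) := by
  rw [exact_differential_iff hu'' hu']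
  refine fun p hp => ⟨h p hp, ?_⟩
  rintro ⟨c, hc, hpc⟩ y hy
  -- Independence of `G` is only assumed for nonempty `G'`; otherwise the sum is empty.
  obtain rfl | hne := G'.eq_empty_or_nonempty
  · simp
  have hind := hG hne
  have h1 : ∑ x ∈ G', r x y * (terminus x * (p x - ∑ w ∈ G'', r' w x * c w)) ∈ I :=
    sum_mem fun x hx => I.mul_mem_left _ _ (hpc x hx)
  have h2 : ∑ x ∈ G', r x y * (terminus x * (p x - ∑ w ∈ G'', r' w x * c w)) =
      ∑ x ∈ G', r x y * p x - ∑ w ∈ G'', (∑ x ∈ G', r x y * r' w x) * c w := by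
    simp only [Finset.sum_mul]
    rw [Finset.sum_comm, ← Finset.sum_sub_distrib]
    refine Finset.sum_congr rfl fun x hx => ?_
    rw [← mul_assoc, (hr x hx).mul_terminus hind (hu' x hx) y hy, mul_sub, Finset.mul_sum]
    simp only [mul_assoc]
  have h3 : ∑ w ∈ G'', (∑ x ∈ G', r x y * r' w x) * c w ∈ I := by
    refine sum_mem fun w hw => I.mul_mem_right _ _ ?_
    obtain ⟨s, hs, hsI⟩ := hI w hw
    have := hind.unique ((hr' w hw).comp hr) hs y hy
    rw [this]
    exact hsI y hy
  rw [h2] at h1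
  refine I.mul_mem_left _ _ ?_
  simpa using I.add_mem h1 h3

end PathAlgebra

namespace Stretched

open PathAlgebra

variable {A : ℕ} {K : Type w} {V : Type u} [Field K] [Quiver.{v} V] [Fintype V]
  [Fintype (Quiver.Total V)]

/-! ### The sets `g̃ⁿ` -/

theorem isUniform_theta (hA : 1 ≤ A) {x : PathAlgebra K V} (hx : IsUniform x) :
    IsUniform (theta K A V x) := by
  obtain ⟨h0, ⟨a, ha⟩, b, hb⟩ := hx
  refine ⟨fun h => h0 (theta_injective hA (h.trans (map_zero _).symm)), ⟨old a, ?_⟩, old b, ?_⟩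
  · rw [← theta_vertex, ← map_mul, ha]
  · rw [← theta_vertex, ← map_mul, hb]

theorem terminus_theta (hA : 1 ≤ A) {x : PathAlgebra K V} (hx : IsUniform x) :
    terminus (theta K A V x) = theta K A V (terminus x) := by
  obtain ⟨b, hb, hxb⟩ := hx.exists_terminus_eq
  rw [hb, theta_vertex]
  refine terminus_eq (isUniform_theta hA hx).1 ?_
  rw [← theta_vertex, ← map_mul, hxb]

theorem isExpansion_theta (hA : 1 ≤ A) {G : Finset (PathAlgebra K V)}
    {G' : Finset (PathAlgebra K (Stretched A V))} [DecidableEq (PathAlgebra K (Stretched A V))]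
    (hG' : G' = G.image (theta K A V)) (hG : ∀ y ∈ G, IsUniform y) {x : PathAlgebra K V}
    {c : PathAlgebra K V → PathAlgebra K V} (hc : IsExpansion G x c) :
    IsExpansion G' (theta K A V x) fun Y => theta K A V (c (Function.invFun (theta K A V) Y)) := by
  have hinv := Function.leftInverse_invFun (theta_injective (K := K) (V := V) hA)
  subst hG'
  refine ⟨fun Y hY => ?_, ?_⟩
  · obtain ⟨y, hy, rfl⟩ := Finset.mem_image.1 hY
    beta_reduce
    rw [terminus_theta hA (hG y hy), hinv y, ← map_mul, hc.1 y hy]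
  · rw [Finset.sum_image (theta_injective hA).injOn]
    nth_rewrite 1 [hc.2]
    rw [map_sum]
    refine Finset.sum_congr rfl fun y _ => ?_
    beta_reduce
    rw [hinv y, map_mul]

theorem eq_zero_of_coord_eq_zero {z : PathAlgebra K (Stretched A V)}
    (hz : theta K A V 1 * z = z) (h : ∀ x, coord x z = 0) : z = 0 := by
  rw [← hz, theta_one_mul]
  simp only [h, map_zero, zero_mul, Finset.sum_const_zero]

theorem theta_one_mul_eq {a : PathAlgebra K V} {z : PathAlgebra K (Stretched A V)}
    (h : theta K A V a * z = z) : theta K A V 1 * z = z := by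
  rw [← h, ← mul_assoc, theta_one_mul_theta]

/-- Each coordinate turns a relation among the θ*(y) into a relation among the y, and the
coordinates determine the coefficients. -/
theorem rightIndependent_theta (hA : 1 ≤ A) {G : Finset (PathAlgebra K V)}
    {G' : Finset (PathAlgebra K (Stretched A V))} [DecidableEq (PathAlgebra K (Stretched A V))]
    (hG' : G' = G.image (theta K A V)) (hu : ∀ y ∈ G, IsUniform y) (hG : RightIndependent G) :
    RightIndependent G' := by
  subst hG'
  intro c hc h0 Y hY
  obtain ⟨y, hy, rfl⟩ := Finset.mem_image.1 hY
  rw [Finset.sum_image (theta_injective hA).injOn] at h0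
  have hc' : ∀ y ∈ G, theta K A V (terminus y) * c (theta K A V y) = c (theta K A V y) := by
    intro y hy
    rw [← terminus_theta hA (hu y hy)]
    exact hc _ (Finset.mem_image_of_mem _ hy)
  refine eq_zero_of_coord_eq_zero (theta_one_mul_eq (hc' y hy)) fun x => ?_
  refine hG (fun y => coord x (c (theta K A V y))) (fun y hy => ?_) ?_ y hy
  · rw [← coord_theta_mul hA, hc' y hy]
  · have := congrArg (coord x) h0
    rw [map_sum, map_zero] at this
    rw [← this]
    exact Finset.sum_congr rfl fun y _ => (coord_theta_mul hA x y _).symm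

/-- θ* of an arrow has no constant coefficient, so the Leibniz rule differentiates only this first
factor and keeps θ*(c y) on the right. -/
theorem leftDeriv_theta (hA : 1 ≤ A) {G : Finset (PathAlgebra K V)}
    (hG : (G : Set (PathAlgebra K V)) = Set.range arrow) {x : PathAlgebra K V}
    {c : PathAlgebra K V → PathAlgebra K V} (hc : IsExpansion G x c)
    (β : Quiver.Total (Stretched A V)) :
    leftDeriv β (theta K A V x) =
      ∑ y ∈ G, leftDeriv β (theta K A V y) * theta K A V (c y) := by
  nth_rewrite 1 [hc.2]
  rw [map_sum, map_sum]
  refine Finset.sum_congr rfl fun y hy => ?_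
  rw [← Finset.mem_coe, hG] at hy
  obtain ⟨α, rfl⟩ := hy
  rw [map_mul, leftDeriv_mul, constCoeff_theta hA (fun b => constCoeff_arrow b α), zero_smul,
    add_zero]

theorem constCoeff_eq_zero_of_mem_ideal (hA : 1 ≤ A) {S : Set (PathAlgebra K V)}
    (hS : ∀ x ∈ S, ∀ a, constCoeff a x = 0) {z : PathAlgebra K (Stretched A V)}
    (hz : z ∈ ideal A S) (y : Stretched A V) : constCoeff y z = 0 := by
  rw [ideal, TwoSidedIdeal.mem_span_iff_mem_addSubgroup_closure] at hz
  induction hz using AddSubgroup.closure_induction with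
  | mem a h =>
    obtain ⟨_, ⟨b, -, _, ⟨s, hs, rfl⟩, rfl⟩, c, -, rfl⟩ := h
    change constCoeff y (b * theta K A V s * c) = 0
    rw [constCoeff_mul, constCoeff_mul, constCoeff_theta hA (hS s hs), mul_zero, zero_mul]
  | zero => rw [map_zero]
  | add a b _ _ ha hb => rw [map_add, ha, hb, add_zero]
  | neg a _ ha => rw [map_neg, ha, neg_zero]

/-! ### Transfer of exactness -/

/-- For every vertex `v` of 𝒬̃ the coordinates at `v` solve the system modulo I, so exactness over Λ
supplies coefficients `c v`. Multiplying by the stubs and summing over `v` gives the coefficients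
over 𝒬̃. -/
theorem exists_coeff_of_exact (hA : 1 ≤ A) {S : Set (PathAlgebra K V)}
    {G G' G'' : Finset (PathAlgebra K V)}
    {r r' : PathAlgebra K V → PathAlgebra K V → PathAlgebra K V}
    (hu' : ∀ x ∈ G', IsUniform x) (hu'' : ∀ x ∈ G'', IsUniform x)
    (hex : Function.Exact (differential (TwoSidedIdeal.span S) G'' G' r')
      (differential (TwoSidedIdeal.span S) G' G r))
    (p : PathAlgebra K V → PathAlgebra K (Stretched A V))
    (hp : ∀ x ∈ G', theta K A V (terminus x) * p x = p x)
    (h : ∀ y ∈ G, ∑ x ∈ G', theta K A V (r x y) * p x ∈ ideal A S) :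
    ∃ c : PathAlgebra K V → PathAlgebra K (Stretched A V),
      (∀ w ∈ G'', theta K A V (terminus w) * c w = c w) ∧
      ∀ x ∈ G', theta K A V (terminus x) *
        (p x - ∑ w ∈ G'', theta K A V (r' w x) * c w) ∈ ideal A S := by
  rw [exact_differential_iff hu'' hu'] at hex
  have hv : ∀ v : Stretched A V, ∃ c : PathAlgebra K V → PathAlgebra K V,
      (∀ w ∈ G'', terminus w * c w = c w) ∧ ∀ x ∈ G', terminus x *
        (coord v (p x) - ∑ w ∈ G'', r' w x * c w) ∈ TwoSidedIdeal.span S := by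
    intro v
    refine (hex (fun x => coord v (p x)) fun x hx => ?_).1 fun y hy => ?_
    · rw [← coord_theta_mul hA, hp x hx]
    · refine TwoSidedIdeal.mul_mem_left _ _ _ ?_
      have := coord_mem_span hA (h y hy) v
      rw [map_sum] at this
      simpa only [coord_theta_mul hA] using this
  choose c hc hc' using hv
  refine ⟨fun w => ∑ v, theta K A V (c v w) * stub v, fun w hw => ?_, fun x hx => ?_⟩
  · rw [Finset.mul_sum]
    refine Finset.sum_congr rfl fun v _ => ?_
    rw [← mul_assoc, ← map_mul, hc v w hw]
  · have e : theta K A V (terminus x) *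
        (p x - ∑ w ∈ G'', theta K A V (r' w x) * ∑ v, theta K A V (c v w) * stub v) =
        ∑ v, theta K A V (terminus x * (coord v (p x) - ∑ w ∈ G'', r' w x * c v w)) * stub v := by
      have h1 : p x = ∑ v, theta K A V (coord v (p x)) * stub v := by
        rw [← theta_one_mul, theta_one_mul_eq (hp x hx)]
      have h2 : ∑ w ∈ G'', theta K A V (r' w x) * ∑ v, theta K A V (c v w) * stub v =
          ∑ v, theta K A V (∑ w ∈ G'', r' w x * c v w) * stub v := by
        simp only [Finset.mul_sum, map_sum, Finset.sum_mul, map_mul, mul_assoc]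
        exact Finset.sum_comm
      nth_rewrite 1 [h1]
      rw [h2, ← Finset.sum_sub_distrib, Finset.mul_sum]
      refine Finset.sum_congr rfl fun v _ => ?_
      rw [map_mul, map_sub, mul_assoc, sub_mul]
    rw [e]
    exact sum_mem fun v _ => TwoSidedIdeal.mul_mem_right _ _ _ (theta_mem_ideal (hc' v x hx))

end Stretched

/-! ### Assembly of the stretched resolution -/

namespace Stretched

open PathAlgebra

/-- The sets `g̃ⁿ` define a minimal projective resolution, with differentials induced by `θ*`. -/
theorem exists_isResolutionBySets_sets {K : Type*} [Field K] {V : Type*} [Quiver V] [Fintype V]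
    [Fintype (Quiver.Total V)] (A : ℕ) (hA : 1 ≤ A)
    (I : TwoSidedIdeal (PathAlgebra K V)) (hI : PathAlgebra.IsAdmissible I)
    (g : ℕ → Finset (PathAlgebra K V))
    (r : ℕ → PathAlgebra K V → PathAlgebra K V → PathAlgebra K V)
    (h : PathAlgebra.IsResolutionBySets I g r) :
    ∃ r' : ℕ → PathAlgebra K (Stretched A V) → PathAlgebra K (Stretched A V) →
        PathAlgebra K (Stretched A V),
      PathAlgebra.IsResolutionBySets
        (Stretched.ideal A (g 2 : Set (PathAlgebra K V))) (Stretched.sets A g) r' ∧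
      ∀ n, 2 ≤ n → ∀ x ∈ g (n + 1), ∀ y ∈ g n,
        r' n (Stretched.theta K A V x) (Stretched.theta K A V y) =
          Stretched.theta K A V (r n x y) := by
  classical
  obtain ⟨hI2, N, -, hN⟩ := hI
  obtain rfl := h.g_two_span
  have hθ := theta_injective (K := K) (V := V) hA
  have hI0 : ∀ x ∈ TwoSidedIdeal.span (g 2 : Set (PathAlgebra K V)), ∀ a, constCoeff a x = 0 :=
    fun x hx => constCoeff_eq_zero_of_mem (by norm_num) (hI2 x hx)
  have hg2 : ∀ x ∈ (g 2 : Set (PathAlgebra K V)), ∀ a, constCoeff a x = 0 :=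
    fun x hx => hI0 x (TwoSidedIdeal.subset_span hx)
  have hIt0 : ∀ z ∈ ideal A (g 2 : Set (PathAlgebra K V)), ∀ a, constCoeff a z = 0 :=
    fun z hz => constCoeff_eq_zero_of_mem_ideal hA hg2 hz
  have hNt := arrowIdealPow_subset_ideal hA hN
  have hs : ∀ n, sets A g (n + 2) = (g (n + 2)).image (theta K A V) := by
    intro n
    rw [sets]
  have h0 : (sets A g 0 : Set (PathAlgebra K (Stretched A V))) = Set.range vertex := by
    rw [sets, Finset.coe_image, Finset.coe_univ, Set.image_univ]
  have h1 : (sets A g 1 : Set (PathAlgebra K (Stretched A V))) = Set.range arrow := by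
    rw [sets, Finset.coe_image, Finset.coe_univ, Set.image_univ]
  have hu : ∀ n, ∀ x ∈ sets A g n, IsUniform x := by
    rintro (_ | _ | n) x hx
    · rw [← Finset.mem_coe, h0] at hx
      obtain ⟨a, rfl⟩ := hx
      exact isUniform_vertex a
    · rw [← Finset.mem_coe, h1] at hx
      obtain ⟨β, rfl⟩ := hx
      exact isUniform_arrow β
    · rw [hs] at hx
      obtain ⟨y, hy, rfl⟩ := Finset.mem_image.1 hx
      exact isUniform_theta hA (h.uniform _ y hy)
  have hind : ∀ n, (g (n + 1)).Nonempty → RightIndependent (g n) := by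
    rintro n ⟨x, hx⟩
    exact rightIndependent_of_unique (h.expansion n x hx) (h.expansion_unique n x hx)
  have hindt : ∀ n, (sets A g (n + 1)).Nonempty → RightIndependent (sets A g n) := by
    rintro (_ | _ | n) hne
    · exact rightIndependent_vertices h0
    · exact rightIndependent_arrows h1
    · refine rightIndependent_theta hA (hs n) (h.uniform _) (hind _ ?_)
      rw [hs (n + 1)] at hne
      exact Finset.image_nonempty.1 hne
  have hexp : ∀ n, ∀ X ∈ sets A g (n + 1), ∃ c, IsExpansion (sets A g n) X c := by
    rintro (_ | _ | n) X hX
    · exact ⟨_, isExpansion_vertices h0 X⟩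
    · refine ⟨_, isExpansion_arrows h1 fun a => ?_⟩
      rw [hs 0] at hX
      obtain ⟨x, hx, rfl⟩ := Finset.mem_image.1 hX
      exact constCoeff_theta hA (hg2 x hx) a
    · rw [hs (n + 1)] at hX
      obtain ⟨x, hx, rfl⟩ := Finset.mem_image.1 hX
      exact ⟨_, isExpansion_theta hA (hs n) (h.uniform _) (h.expansion (n + 2) x hx)⟩
  -- Coefficients picked by choice; `huniq` later identifies them with the explicit expansions.
  let r' : ℕ → PathAlgebra K (Stretched A V) → PathAlgebra K (Stretched A V) →
      PathAlgebra K (Stretched A V) := fun n X =>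
    if hX : ∃ c, IsExpansion (sets A g n) X c then hX.choose else 0
  have hr' : ∀ n, ∀ X ∈ sets A g (n + 1), IsExpansion (sets A g n) X (r' n X) := by
    intro n X hX
    have := hexp n X hX
    simp only [r', dif_pos this]
    exact this.choose_spec
  have huniq : ∀ n, ∀ X ∈ sets A g (n + 1), ∀ c, IsExpansion (sets A g n) X c →
      ∀ Y ∈ sets A g n, c Y = r' n X Y := fun n X hX c hc =>
    (hindt n ⟨X, hX⟩).unique hc (hr' n X hX)
  have hr'θ : ∀ n, ∀ x ∈ g (n + 3), ∀ y ∈ g (n + 2),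
      r' (n + 2) (theta K A V x) (theta K A V y) = theta K A V (r (n + 2) x y) := by
    intro n x hx y hy
    have hX : theta K A V x ∈ sets A g (n + 3) := by
      rw [hs (n + 1)]
      exact Finset.mem_image_of_mem _ hx
    have hY : theta K A V y ∈ sets A g (n + 2) := by
      rw [hs n]
      exact Finset.mem_image_of_mem _ hy
    rw [← huniq (n + 2) _ hX _
      (isExpansion_theta hA (hs n) (h.uniform _) (h.expansion (n + 2) x hx)) _ hY,
      Function.leftInverse_invFun hθ y]
  have hr'1 : ∀ x ∈ g 2, ∀ β, r' 1 (theta K A V x) (arrow β) = leftDeriv β (theta K A V x) := by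
    intro x hx β
    have hX : theta K A V x ∈ sets A g 2 := by
      rw [hs 0]
      exact Finset.mem_image_of_mem _ hx
    have hY : arrow β ∈ sets A g 1 := by
      rw [← Finset.mem_coe, h1]
      exact ⟨β, rfl⟩
    rw [← huniq 1 _ hX _ (isExpansion_arrows h1 (constCoeff_theta hA (hg2 x hx))) _ hY,
      arrowCoeff_arrow]
  have hrJ : ∀ n, ∀ x ∈ g (n + 1), ∀ y ∈ g n, ∀ a, constCoeff a (r n x y) = 0 := fun n =>
    (range_differential_le_jacobson_iff hN hI0 (h.uniform _)
      (fun x hx => (h.expansion n x hx).1) (fun x hx => (h.expansion n x hx).mul_terminus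
        (hind n ⟨x, hx⟩) (h.uniform _ x hx))).1 (h.resolution.minimal n)
  have hideal : ∀ n, ∀ X ∈ sets A g (n + 3), ∃ s, IsExpansion (sets A g (n + 1)) X s ∧
      ∀ Y ∈ sets A g (n + 1), s Y ∈ ideal A (g 2 : Set (PathAlgebra K V)) := by
    intro n X hX
    rw [hs (n + 1)] at hX
    obtain ⟨x, hx, rfl⟩ := Finset.mem_image.1 hX
    obtain ⟨s, hs1, hs2, -⟩ := h.expansion_ideal n x hx
    -- Over the arrows of 𝒬̃ the coefficients of θ*(x) are derivatives, and these are left multiples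
    -- of the elements θ*(s y) of the stretched ideal.
    rcases n with _ | n
    · have hx0 : ∀ a, constCoeff a x = 0 := by
        intro a
        rw [hs1.2, map_sum]
        refine Finset.sum_eq_zero fun y hy => ?_
        rw [constCoeff_mul, hI0 _ (hs2 y hy), mul_zero]
      refine ⟨_, isExpansion_arrows h1 (constCoeff_theta hA hx0), fun Y hY => ?_⟩
      rw [← Finset.mem_coe, h1] at hY
      obtain ⟨β, rfl⟩ := hY
      rw [arrowCoeff_arrow, leftDeriv_theta hA h.g_one hs1]
      exact sum_mem fun y hy => TwoSidedIdeal.mul_mem_left _ _ _ (theta_mem_ideal (hs2 y hy))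
    · refine ⟨_, isExpansion_theta hA (hs n) (h.uniform _) hs1, fun Y hY => ?_⟩
      rw [hs n] at hY
      obtain ⟨y, hy, rfl⟩ := Finset.mem_image.1 hY
      rw [Function.leftInverse_invFun hθ y]
      exact theta_mem_ideal (hs2 y hy)
  have hexact : ∀ n, Function.Exact
      (differential (ideal A (g 2 : Set (PathAlgebra K V))) (sets A g (n + 3)) (sets A g (n + 2))
        (r' (n + 2)))
      (differential (ideal A (g 2 : Set (PathAlgebra K V))) (sets A g (n + 2)) (sets A g (n + 1))
        (r' (n + 1))) := by
    intro n
    refine exact_differential_of (hu _) (hu _) (hindt _) (hr' _) (hr' _) (hideal n) ?_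
    intro p hp hpI
    have hp' : ∀ x ∈ g (n + 2), theta K A V (terminus x) * p (theta K A V x) =
        p (theta K A V x) := by
      intro x hx
      rw [← terminus_theta hA (h.uniform _ x hx)]
      exact hp _ (by rw [hs n]; exact Finset.mem_image_of_mem _ hx)
    have hpI' : ∀ y ∈ g (n + 1), ∑ x ∈ g (n + 2), theta K A V (r (n + 1) x y) *
        p (theta K A V x) ∈ ideal A (g 2 : Set (PathAlgebra K V)) := by
      intro y hy
      rw [hs n] at hpI
      simp only [Finset.sum_image hθ.injOn] at hpI
      rcases n with _ | n
      · have hy' := hy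
        rw [← Finset.mem_coe, h.g_one] at hy'
        obtain ⟨α, rfl⟩ := hy'
        -- Among the arrows that replace α the entry at α₁ suffices: it equals Tθ*(r) with T =
        -- α₂⋯α_A, and T cancels modulo the ideal.
        obtain ⟨T, hT1, hT2, hT3⟩ := exists_arrow_mul_eq (K := K) hA α
        have hr'T : ∀ x ∈ g 2, r' 1 (theta K A V x) (arrow (arr α ⟨0, hA⟩)) =
            T * theta K A V (r 1 x (arrow α)) := by
          intro x hx
          rw [hr'1 x hx, leftDeriv_theta hA h.g_one (h.expansion 1 x hx),
            Finset.sum_eq_single (arrow α)]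
          · rw [← hT1, leftDeriv_arrow_mul, if_pos rfl]
            exact congrArg (· * _) hT2
          -- θ* of any other arrow γ begins with γ₁ ≠ α₁, so its derivative along α₁ is zero.
          · intro y hy hne
            rw [← Finset.mem_coe, h.g_one] at hy
            obtain ⟨γ, rfl⟩ := hy
            obtain ⟨T', hT', -⟩ := exists_arrow_mul_eq (K := K) hA γ
            rw [← hT', leftDeriv_arrow_mul, if_neg, zero_mul]
            intro e
            exact hne (congrArg arrow (arr_injective e))
          · exact fun h => (h hy).elim
        have hY : arrow (arr α ⟨0, hA⟩) ∈ sets A g 1 := by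
          rw [← Finset.mem_coe, h1]
          exact ⟨_, rfl⟩
        have h2 := hpI _ hY
        have h3 : terminus (arrow (arr α ⟨0, hA⟩)) * ∑ x ∈ g 2,
            r' 1 (theta K A V x) (arrow (arr α ⟨0, hA⟩)) * p (theta K A V x) =
            T * ∑ x ∈ g 2, theta K A V (r 1 x (arrow α)) * p (theta K A V x) := by
          rw [terminus_arrow, Finset.mul_sum, Finset.mul_sum]
          refine Finset.sum_congr rfl fun x hx => ?_
          rw [hr'T x hx, mul_assoc, ← mul_assoc]
          exact congrArg (· * _) hT2
        have h4 := hT3 _ _ (h3 ▸ h2)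
        rw [← theta_vertex, Finset.mul_sum] at h4
        convert h4 using 1
        refine Finset.sum_congr rfl fun x hx => ?_
        rw [← mul_assoc, ← map_mul, ← terminus_arrow, (h.expansion 1 x hx).1 _ hy]
      · have hY : theta K A V y ∈ sets A g (n + 2) := by
          rw [hs n]
          exact Finset.mem_image_of_mem _ hy
        have h2 := hpI _ hY
        rw [terminus_theta hA (h.uniform _ y hy), Finset.mul_sum] at h2
        convert h2 using 1
        refine Finset.sum_congr rfl fun x hx => ?_
        rw [hr'θ n x hx y hy, ← mul_assoc, ← map_mul, (h.expansion _ x hx).1 _ hy]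
    obtain ⟨c, hc, hc'⟩ := exists_coeff_of_exact hA (h.uniform _) (h.uniform _)
      (h.resolution.exact_succ (n + 1)) (fun x => p (theta K A V x)) hp' hpI'
    have hinv := Function.leftInverse_invFun hθ
    refine ⟨fun W => c (Function.invFun (theta K A V) W), fun W hW => ?_, fun X hX => ?_⟩
    · rw [hs (n + 1)] at hW
      obtain ⟨w, hw, rfl⟩ := Finset.mem_image.1 hW
      beta_reduce
      rw [hinv w, terminus_theta hA (h.uniform _ w hw), hc w hw]
    · rw [hs n] at hX
      obtain ⟨x, hx, rfl⟩ := Finset.mem_image.1 hX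
      rw [hs (n + 1), Finset.sum_image hθ.injOn, terminus_theta hA (h.uniform _ x hx)]
      convert hc' x hx using 3
      refine Finset.sum_congr rfl fun w hw => ?_
      beta_reduce
      rw [hinv w, hr'θ n w hw x hx]
  refine ⟨r', ⟨h0, h1, ?_, ?_, hu, hr', huniq, ?_, ⟨fun n => projective_proj _ (hu n), ?_, ?_, ?_,
    fun n => ?_⟩⟩, ?_⟩
  · rw [hs 0, Finset.coe_image]
    rfl
  · intro S hS he
    rw [hs 0, Finset.coe_image] at hS
    obtain ⟨S', hS', rfl⟩ := Set.subset_image_iff.1 hS.1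
    -- If θ*(S') generated the stretched ideal, membership would descend along θ* and `S'` would
    -- generate I, against the minimality of `g 2`.
    refine h.g_two_minimal S' ⟨hS', fun hle => hS.2 (Set.image_mono hle)⟩ ?_
    refine le_antisymm (TwoSidedIdeal.span_mono hS') (TwoSidedIdeal.span_le.2 fun x hx => ?_)
    refine (theta_mem_ideal_iff hA).1 ?_
    rw [ideal, he]
    exact theta_mem_ideal (TwoSidedIdeal.subset_span hx)
  · intro n X hX
    obtain ⟨s, hs1, hs2⟩ := hideal n X hX
    refine ⟨s, hs1, hs2, fun s' hs' _ => ?_⟩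
    refine RightIndependent.unique (hindt (n + 1) ?_) hs' hs1
    rw [hs (n + 1)] at hX
    obtain ⟨x, hx, -⟩ := Finset.mem_image.1 hX
    rw [hs n]
    -- An empty `g (n + 2)` would make `x` an empty sum, although uniform elements are nonzero.
    refine Finset.Nonempty.image (Finset.nonempty_iff_ne_empty.2 fun he => ?_) _
    apply (h.uniform _ x hx).1
    rw [(h.expansion (n + 2) x hx).2, he, Finset.sum_empty]
  · intro t
    obtain ⟨z, rfl⟩ := Submodule.Quotient.mk_surjective _ t
    obtain ⟨z, rfl⟩ := mk_surjective _ z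
    have he := isExpansion_vertices h0 z
    refine ⟨mkProj _ _ fun y => y * z, ?_⟩
    rw [augmentation_mkProj he.1, ← Finset.sum_mul, sum_vertices h0, one_mul]
  · exact exact_augmentation hNt hIt0 h0 h1 (hu 0) (hu 1) (hr' 0)
  · rintro (_ | n)
    · refine exact_differential_arrows h0 h1 ?_ ?_ (hu 1) (hu 2) (hr' 0) (hr' 1)
      · rw [hs 0, Finset.coe_image]
        rfl
      · intro X hX
        rw [hs 0] at hX
        obtain ⟨x, hx, rfl⟩ := Finset.mem_image.1 hX
        exact constCoeff_theta hA (hg2 x hx)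
    · exact hexact n
  · refine (range_differential_le_jacobson_iff hNt hIt0 (hu _)
      (fun x hx => (hr' n x hx).1) (fun x hx => (hr' n x hx).mul_terminus
        (hindt n ⟨x, hx⟩) (hu _ x hx))).2 fun X hX Y hY a => ?_
    -- The entries have no constant coefficients because they are, in turn, multiples of arrows,
    -- combinations of the elements θ*(r) on the right, and the elements θ*(r) themselves.
    rcases n with _ | _ | n
    · rw [← huniq 0 X hX _ (isExpansion_vertices h0 X) Y hY, constCoeff_mul]
      rw [← Finset.mem_coe, h1] at hX
      obtain ⟨β, rfl⟩ := hX
      rw [constCoeff_arrow, mul_zero]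
    · rw [hs 0] at hX
      obtain ⟨x, hx, rfl⟩ := Finset.mem_image.1 hX
      rw [← Finset.mem_coe, h1] at hY
      obtain ⟨β, rfl⟩ := hY
      rw [hr'1 x hx, leftDeriv_theta hA h.g_one (h.expansion 1 x hx), map_sum]
      refine Finset.sum_eq_zero fun y hy => ?_
      rw [constCoeff_mul, constCoeff_theta hA (hrJ 1 x hx y hy), mul_zero]
    · rw [hs (n + 1)] at hX
      obtain ⟨x, hx, rfl⟩ := Finset.mem_image.1 hX
      rw [hs n] at hY
      obtain ⟨y, hy, rfl⟩ := Finset.mem_image.1 hY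
      rw [hr'θ n x hx y hy]
      exact constCoeff_theta hA (hrJ _ x hx y hy) a
  · intro n hn x hx y hy
    obtain ⟨n, rfl⟩ := Nat.exists_eq_add_of_le' hn
    exact hr'θ n x hx y hy

end Stretched

end

theorem mainTheorem5 {K : Type*} [Field K] {V : Type*} [Quiver V] [Fintype V]
    [Fintype (Quiver.Total V)] (A : ℕ) (hA : 1 ≤ A)
    (I : TwoSidedIdeal (PathAlgebra K V)) (hI : PathAlgebra.IsAdmissible I)
    (g : ℕ → Finset (PathAlgebra K V))
    (r : ℕ → PathAlgebra K V → PathAlgebra K V → PathAlgebra K V)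
    (h : PathAlgebra.IsResolutionBySets I g r) :
    ∃ r' : ℕ → PathAlgebra K (Stretched A V) → PathAlgebra K (Stretched A V) →
        PathAlgebra K (Stretched A V),
      PathAlgebra.IsResolutionBySets
        (Stretched.ideal A (g 2 : Set (PathAlgebra K V))) (Stretched.sets A g) r' ∧
      ∀ n, 2 ≤ n → ∀ x ∈ g (n + 1), ∀ y ∈ g n,
        r' n (Stretched.theta K A V x) (Stretched.theta K A V y) =
          Stretched.theta K A V (r n x y) :=
  Stretched.exists_isResolutionBySets_sets A hA I hI g r h
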